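/- Consider a first-come-first-served single-server queue, empty at time $0$, used as a timing channel: packets arrive at instants $0\le a_1\le a_2\le\dots\le a_n$ (integers in the discrete-time model, reals in the continuous-time model) and depart at $d_i=\max(a_i,d_{i-1})+S_i$ with $d_0=0$, where the service times $S_i$ are i.i.d. copies of $S$ and $\mu=1/\mathbb E[S]$. An $(n,M,T,\epsilon)$-code sends one of $M$ equiprobable messages $u$ by choosing the arrival instants, in such a way that $\mathbb E[d_n]\le T$ and that a decoder recovers $u$ from $(d_1,\dots,d_n)$ with error probability at most $\epsilon$. Without feedback the $a_i$ depend on $u$ only; with feedback $a_i$ may also depend causally on the past departures (whether $a_i=t$ depends only on $u$ and on the departures before $t$). The capacity $C$ (without feedback), respectively $C_F$ (with feedback), is the supremum of the $R$ such that for every $\gamma>0$ there are $(n,M,T,\epsilon_T)$-codes of that kind with $T\to\infty$, $\epsilon_T\to0$ and $\frac{\log_2 M}{T}>R-\gamma$. The capacity $C(\lambda)$, respectively $C_F(\lambda)$, at output rate $\lambda$ is the supremum of the $R$ such that for every $\gamma>0$ there are $(n,M,n/\lambda,\epsilon_n)$-codes of that kind with $n\to\infty$, $\epsilon_n\to0$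 and $\lambda\frac{\log_2M}{n}>R-\gamma$. Let $H$ denote Shannon entropy in the discrete-time model and differential entropy in the continuous-time model. Suppose that either time is discrete and $\mathbb P(S=1)=\mathbb P(S=2)=\frac12$ (so $\mu=\frac23$), or time is continuous and $S$ is uniform on $[0,1]$ (so $\mu=2$). Then for every $\lambda$ with $0<\lambda<\mu$, $$\sup_{X:\ \mathbb E[(X-S_1)^+]\le\frac1\lambda-\frac1\mu}H\big((X-S_1)^++S_2\big)\;<\;\sup_{W\ge0:\ \mathbb E[W]\le\frac1\lambda-\frac1\mu}H(W+S),$$ where $S_1,S_2$ are distributed as $S$, where $X$ (integer-valued in discrete time, real-valued in continuous time), $S_1$ and $S_2$ are independent, and where $W$ (integer-valued in discrete time, real-valued in continuous time) is independent of $S$. Moreover, feedback increases capacity: $C(\lambda)<C_F(\lambda)$ for every $0<\lambda<\mu$, and $C<C_F$. -/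

import Mathlib

open MeasureTheory Filter Topology
open scoped ENNReal

noncomputable section

/-- The two time models: time is discrete (integer instants) or continuous (real instants). -/
inductive TimeModel
  | discrete
  | continuous

/-- The instants at which packets may arrive. -/
def TimeModel.instants : TimeModel → Set ℝ
  | .discrete => Set.range (fun k : ℤ => (k : ℝ))
  | .continuous => Set.univ

/-- Shannon entropy, in bits, of a probability law concentrated on the integers. -/
def discreteEntropy (P : Measure ℝ) : EReal :=
  ((∑' k : ℤ, ENNReal.ofReal (-(P.real {(k : ℝ)} * Real.logb 2 (P.real {(k : ℝ)}))) : ℝ≥0∞) : EReal)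

open Classical in
/-- Differential entropy, in bits: with `f` the density of `P`, the integral of `-f log f`, that is
the integral of its positive part minus that of its negative part. The value is `-∞` if `P` has no
density (and in the undefined case `∞ - ∞`). -/
def differentialEntropy (P : Measure ℝ) : EReal :=
  if P ≪ volume then
    ((∫⁻ x, ENNReal.ofReal
        (-((P.rnDeriv volume x).toReal * Real.logb 2 (P.rnDeriv volume x).toReal)) : ℝ≥0∞) : EReal) -
    ((∫⁻ x, ENNReal.ofReal
        ((P.rnDeriv volume x).toReal * Real.logb 2 (P.rnDeriv volume x).toReal) : ℝ≥0∞) : EReal)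
  else ⊥

/-- The entropy used in each time model. -/
def TimeModel.entropy : TimeModel → Measure ℝ → EReal
  | .discrete => discreteEntropy
  | .continuous => differentialEntropy

/-- The service rate: the reciprocal of the mean service time. -/
def serviceRate (ν : Measure ℝ) : ℝ := (∫ s, s ∂ν)⁻¹

/-! ### The two entropy maximization problems -/

/-- The law of `U + S` for independent `U ∼ Q` and `S ∼ ν`. -/
def outputLaw (ν Q : Measure ℝ) : Measure ℝ :=
  (Q.prod ν).map (fun p : ℝ × ℝ => p.1 + p.2)

/-- The law of `(X - S)⁺` for independent `X ∼ P` and `S ∼ ν`. -/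
def waitingLaw (ν P : Measure ℝ) : Measure ℝ :=
  (P.prod ν).map (fun p : ℝ × ℝ => max (p.1 - p.2) 0)

/-- The supremum of `H(W + S)` over laws of `W ≥ 0`, independent of `S ∼ ν`, with `𝔼[W] ≤ a`. -/
def maxEntropyFree (tm : TimeModel) (ν : Measure ℝ) (a : ℝ) : EReal :=
  ⨆ (Q : ProbabilityMeasure ℝ)
    (_ : ∀ᵐ w ∂(Q : Measure ℝ), 0 ≤ w ∧ w ∈ tm.instants)
    (_ : ∫⁻ w, ENNReal.ofReal w ∂(Q : Measure ℝ) ≤ ENNReal.ofReal a),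
    tm.entropy (outputLaw ν Q)

/-- The supremum of `H((X - S₁)⁺ + S₂)` over laws of `X`, where `X`, `S₁ ∼ ν`, `S₂ ∼ ν` are
independent and `𝔼[(X - S₁)⁺] ≤ a`. -/
def maxEntropySmeared (tm : TimeModel) (ν : Measure ℝ) (a : ℝ) : EReal :=
  ⨆ (P : ProbabilityMeasure ℝ)
    (_ : ∀ᵐ x ∂(P : Measure ℝ), x ∈ tm.instants)
    (_ : ∫⁻ w, ENNReal.ofReal w ∂(waitingLaw ν P) ≤ ENNReal.ofReal a),
    tm.entropy (outputLaw ν (waitingLaw ν P))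

/-! ### The queue, codes and capacities -/

/-- The last of the first `n` departure instants (`0` if `n = 0`). -/
def lastDeparture : (n : ℕ) → (Fin n → ℝ) → ℝ
  | 0, _ => 0
  | n + 1, d => d (Fin.last n)

/-- The first `n` departure instants of a FIFO single-server queue that is empty at time `0`, when
the service times are `s` and packet `i` (counted from `0`) arrives at the instant `enc i h`, with
`h` the departure instants of the packets before it: `dᵢ = max (aᵢ, dᵢ₋₁) + sᵢ`. -/
def departures (enc : (i : ℕ) → (Fin i → ℝ) → ℝ) : (n : ℕ) → (Fin n → ℝ) → (Fin n → ℝ)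
  | 0, _ => Fin.elim0
  | n + 1, s =>
      Fin.snoc (α := fun _ => ℝ) (departures enc n (Fin.init s))
        (max (enc n (departures enc n (Fin.init s)))
            (lastDeparture n (departures enc n (Fin.init s)))
          + s (Fin.last n))

/-- The corresponding arrival instants. -/
def arrivals (enc : (i : ℕ) → (Fin i → ℝ) → ℝ) (n : ℕ) (s : Fin n → ℝ) (i : Fin n) : ℝ :=
  enc i (fun k : Fin i => departures enc n s (k.castLE i.isLt.le))

/-- An `(n, M, T, ε)`-code for the queue with i.i.d. service times of law `ν`, with feedback if
`feedback = true` and without feedback if `feedback = false`. -/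
structure TimingCode (tm : TimeModel) (ν : Measure ℝ) (feedback : Bool)
    (n M : ℕ) (T ε : ℝ) where
  /-- `enc u i h` is the arrival instant of packet `i` for message `u` after departures `h`. -/
  enc : Fin M → (i : ℕ) → (Fin i → ℝ) → ℝ
  /-- The decoder. -/
  dec : (Fin n → ℝ) → Fin M
  measurable_enc : ∀ u i, Measurable (enc u i)
  measurable_dec : Measurable dec
  /-- Causality: whether packet `i` arrives at time `t` depends only on the departures that
  take place before `t`. -/
  causal : ∀ u i (h h' : Fin i → ℝ),
    (∀ k, h k < enc u i h ∨ h' k < enc u i h → h' k = h k) → enc u i h' = enc u i h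
  /-- Without feedback the arrival instants do not depend on the departures at all. -/
  openLoop : feedback = false → ∀ u i (h h' : Fin i → ℝ), enc u i h = enc u i h'
  /-- The arrivals take place at permitted instants from time `0` on, in increasing order. -/
  admissible : ∀ u, ∀ᵐ s ∂(Measure.pi fun _ : Fin n => ν),
    (∀ i, 0 ≤ arrivals (enc u) n s i ∧ arrivals (enc u) n s i ∈ tm.instants) ∧
      Monotone (arrivals (enc u) n s)
  /-- The mean of the last departure instant, over equiprobable messages, is at most `T`. -/
  deadline : (∑ u, ∫⁻ s, ENNReal.ofReal (lastDeparture n (departures (enc u) n s))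
    ∂(Measure.pi fun _ : Fin n => ν)) / (M : ℝ≥0∞) ≤ ENNReal.ofReal T
  /-- The error probability, over equiprobable messages, is at most `ε`. -/
  error : (∑ u, (Measure.pi fun _ : Fin n => ν) {s | dec (departures (enc u) n s) ≠ u}) /
    (M : ℝ≥0∞) ≤ ENNReal.ofReal ε

/-- The rate `R` (bits per unit of time) is achievable. -/
def Achievable (tm : TimeModel) (ν : Measure ℝ) (feedback : Bool) (R : ℝ) : Prop :=
  ∀ γ > 0, ∃ (n M : ℕ → ℕ) (T ε : ℕ → ℝ),
    Tendsto T atTop atTop ∧ Tendsto ε atTop (𝓝 0) ∧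
    ∀ k, Nonempty (TimingCode tm ν feedback (n k) (M k) (T k) (ε k)) ∧
      R - γ < Real.logb 2 (M k) / T k

/-- The rate `R` (bits per unit of time) is achievable at output rate `lam`. -/
def AchievableAt (tm : TimeModel) (ν : Measure ℝ) (feedback : Bool) (lam R : ℝ) : Prop :=
  ∀ γ > 0, ∃ (n M : ℕ → ℕ) (ε : ℕ → ℝ),
    Tendsto n atTop atTop ∧ Tendsto ε atTop (𝓝 0) ∧
    ∀ k, Nonempty (TimingCode tm ν feedback (n k) (M k) (n k / lam) (ε k)) ∧
      R - γ < lam * (Real.logb 2 (M k) / n k)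

/-- The capacity of the queue, without or with feedback. -/
def capacity (tm : TimeModel) (ν : Measure ℝ) (feedback : Bool) : EReal :=
  ⨆ (R : ℝ) (_ : Achievable tm ν feedback R), (R : EReal)

/-- The capacity of the queue at output rate `lam`, without or with feedback. -/
def capacityAt (tm : TimeModel) (ν : Measure ℝ) (feedback : Bool) (lam : ℝ) : EReal :=
  ⨆ (R : ℝ) (_ : AchievableAt tm ν feedback lam R), (R : EReal)

/-! ### The two service time laws -/

/-- The uniform law on `{1, 2}`. -/
def uniformOneTwo : Measure ℝ :=
  (2⁻¹ : ℝ≥0∞) • Measure.dirac 1 + (2⁻¹ : ℝ≥0∞) • Measure.dirac 2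

/-- The uniform law on `[0, 1]`. -/
def uniformUnitInterval : Measure ℝ := volume.restrict (Set.Icc 0 1)

end

/-!
Both models have the same structure. There is a block length `ℓ` (`2` in discrete and `1` in
continuous time) such that a service time is spread evenly over the instants of the block `(0, ℓ]`.
If waiting times are multiples of `ℓ`, then the interdeparture time `W + S` determines `W`, and the
translates of the law of `S` by multiples of `ℓ` tile the positive instants. Let `base` be the sum
of these translates. For `G` geometric of ratio `ρ`, the negative log-likelihood `geometricCost` of
`ℓ G + S` with respect to `base` is affine in the block index, and the mean block index of `w + S`
is exactly `w / ℓ`, for every instant `w ≥ 0`. Hence the mean of the cost over `W + S` is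
`A + B 𝔼[W]` for every `W ≥ 0`, with `A = -log (1 - ρ)` and `B = -log ρ / ℓ`.

*Feedback.* The encoder can create any sequence of waiting times, so it can send words of multiples
of `ℓ` without error (`IsBlockUniform.nonempty_feedbackCode`). There are `exp (n (H(G) + o(1)))`
words of length `n` with the prescribed sum (`tendsto_log_choose_lower`), where
`H(G) = A + B ℓ 𝔼[G]`; so `lam * H(G)` is achievable. Likewise `ℓ G` shows that the unrestricted
maximal entropy is at least `H(S) + H(G)`.

*No feedback.* The waiting time of a packet is `(X - S₁)⁺`, where `S₁` is the service time of the
packet before it and `X` is independent of `S₁`. This smearing keeps the output law away from that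
of `ℓ G + S`: some bounded statistic `L` has nonpositive mean over every output `(X - S₁)⁺ + S₂`, but
positive mean over `ℓ G + S` (`HasSeparatingStatistic`). Tilting the likelihood by `exp (-θ L)` with
a small `θ > 0` gives a cost whose mean over the outputs `(X - S₁)⁺ + S₂` is at most
`(A - δ) + B 𝔼[W]` with `δ > 0` (`IsBlockUniform.exists_isAffineCost_lt`). Gibbs' inequality turns
it into a bound on the entropy of the output, and a change of measure over whole codewords
(`IsBlockUniform.one_sub_mul_log_le`) into a converse: codes without feedback carry at most
`A - δ` nats per packet plus `B` nats per unit of waiting time. This is smaller than what feedback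
achieves by `δ` per packet.

For the capacity without a prescribed output rate, `ρ` is chosen such that `A = B 𝔼[S]`. Then
feedback achieves `B` nats per unit of time, and the converse for codes without feedback is
`B` per unit of time minus `δ` per packet. Mixing in a little of the converse for a larger `ρ`, whose
slope is smaller, covers the codes that send few packets per unit of time
(`capacity_lt_of_hasConverseBound`).
-/

/-! ### Paths of the queue -/

theorem measurable_fin_snoc (n : ℕ) :
    Measurable fun p : (Fin n → ℝ) × ℝ => (Fin.snoc (α := fun _ => ℝ) p.1 p.2 : Fin (n + 1) → ℝ) := by
  refine measurable_pi_iff.2 fun i => ?_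
  induction i using Fin.lastCases with
  | last => simpa using measurable_snd
  | cast i =>
    simp only [Fin.snoc_castSucc]
    exact (measurable_pi_apply i).comp measurable_fst

theorem measurable_fin_init (n : ℕ) :
    Measurable fun d : Fin (n + 1) → ℝ => (Fin.init d : Fin n → ℝ) :=
  measurable_pi_iff.2 fun i => measurable_pi_apply i.castSucc

theorem measurable_lastDeparture (n : ℕ) : Measurable (lastDeparture n) := by
  cases n with
  | zero => exact measurable_const
  | succ n => exact measurable_pi_apply _

theorem measurable_departures {enc : (i : ℕ) → (Fin i → ℝ) → ℝ} (henc : ∀ i, Measurable (enc i))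
    (n : ℕ) : Measurable (departures enc n) := by
  induction n with
  | zero => exact measurable_const
  | succ n ih =>
    have h := ih.comp (measurable_fin_init n)
    exact (measurable_fin_snoc n).comp (h.prodMk
      ((((henc n).comp h).max ((measurable_lastDeparture n).comp h)).add (measurable_pi_apply _)))

/-- Integration of the last of `n + 1` independent coordinates before the others. -/
theorem lintegral_pi_snoc (ν : Measure ℝ) [SigmaFinite ν] (n : ℕ) {f : (Fin (n + 1) → ℝ) → ℝ≥0∞}
    (hf : Measurable f) :
    ∫⁻ s, f s ∂(Measure.pi fun _ : Fin (n + 1) => ν) =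
      ∫⁻ s, ∫⁻ t, f (Fin.snoc (α := fun _ => ℝ) s t) ∂ν ∂(Measure.pi fun _ : Fin n => ν) := by
  have h := (measurePreserving_piFinSuccAbove (fun _ : Fin (n + 1) => ν) (Fin.last n)).symm
  rw [← h.lintegral_comp hf, lintegral_prod_symm]
  · simp [MeasurableEquiv.piFinSuccAbove, Fin.insertNthEquiv, Fin.insertNth_last']
  · exact (hf.comp h.measurable).aemeasurable

theorem departures_snoc (enc : (i : ℕ) → (Fin i → ℝ) → ℝ) (n : ℕ) (s : Fin n → ℝ) (t : ℝ) :
    departures enc (n + 1) (Fin.snoc (α := fun _ => ℝ) s t) =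
      Fin.snoc (α := fun _ => ℝ) (departures enc n s)
        (max (enc n (departures enc n s)) (lastDeparture n (departures enc n s)) + t) := by
  simp only [departures, Fin.init_snoc, Fin.snoc_last]

@[simp]
theorem lastDeparture_snoc (n : ℕ) (d : Fin n → ℝ) (t : ℝ) :
    lastDeparture (n + 1) (Fin.snoc (α := fun _ => ℝ) d t) = t := by
  simp [lastDeparture]

/-- The sum of `c` over the `n` interdeparture times. -/
def pathCost (c : ℝ → ℝ) : (n : ℕ) → (Fin n → ℝ) → ℝ
  | 0, _ => 0
  | n + 1, d => pathCost c n (Fin.init d) + c (d (Fin.last n) - lastDeparture n (Fin.init d))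

@[simp]
theorem pathCost_snoc (c : ℝ → ℝ) (n : ℕ) (d : Fin n → ℝ) (t : ℝ) :
    pathCost c (n + 1) (Fin.snoc (α := fun _ => ℝ) d t) =
      pathCost c n d + c (t - lastDeparture n d) := by
  simp [pathCost]

theorem measurable_pathCost {c : ℝ → ℝ} (hc : Measurable c) (n : ℕ) :
    Measurable (pathCost c n) := by
  induction n with
  | zero => exact measurable_const
  | succ n ih =>
    exact (ih.comp (measurable_fin_init n)).add (hc.comp ((measurable_pi_apply _).sub
      ((measurable_lastDeparture n).comp (measurable_fin_init n))))

theorem pathCost_nonneg {c : ℝ → ℝ} (hc : ∀ x, 0 ≤ c x) (n : ℕ) (d : Fin n → ℝ) :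
    0 ≤ pathCost c n d := by
  induction n with
  | zero => exact le_rfl
  | succ n ih => exact add_nonneg (ih _) (hc _)

/-- Without feedback the arrival instants are a sequence of constants. -/
theorem TimingCode.enc_eq_const {tm : TimeModel} {ν : Measure ℝ} {n M : ℕ} {T ε : ℝ}
    (C : TimingCode tm ν false n M T ε) (u : Fin M) :
    C.enc u = fun i _ => C.enc u i (fun _ => 0) := by
  funext i h
  exact C.openLoop rfl u i _ _

namespace TimeModel

theorem zero_mem_instants (tm : TimeModel) : (0 : ℝ) ∈ tm.instants := by
  cases tm
  · exact ⟨0, by simp⟩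
  · trivial

theorem add_mem_instants {tm : TimeModel} {x y : ℝ} (hx : x ∈ tm.instants)
    (hy : y ∈ tm.instants) : x + y ∈ tm.instants := by
  cases tm
  · obtain ⟨i, rfl⟩ := hx
    obtain ⟨j, rfl⟩ := hy
    exact ⟨i + j, by push_cast; rfl⟩
  · trivial

theorem sub_mem_instants {tm : TimeModel} {x y : ℝ} (hx : x ∈ tm.instants)
    (hy : y ∈ tm.instants) : x - y ∈ tm.instants := by
  cases tm
  · obtain ⟨i, rfl⟩ := hx
    obtain ⟨j, rfl⟩ := hy
    exact ⟨i - j, by push_cast; rfl⟩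
  · trivial

theorem max_mem_instants {tm : TimeModel} {x y : ℝ} (hx : x ∈ tm.instants)
    (hy : y ∈ tm.instants) : max x y ∈ tm.instants := by
  rcases max_choice x y with h | h <;> rw [h] <;> assumption

theorem natCast_mul_mem_instants {tm : TimeModel} {x : ℝ} (hx : x ∈ tm.instants) (k : ℕ) :
    x * k ∈ tm.instants := by
  induction k with
  | zero => simpa using tm.zero_mem_instants
  | succ k ih =>
    rw [Nat.cast_succ, mul_add, mul_one]
    exact add_mem_instants ih hx

end TimeModel

/-! ### Services spread evenly over a block -/

/-- The index of the block `(ℓ k, ℓ (k + 1)]` containing `x > 0`. -/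
noncomputable def blockIndex (ℓ x : ℝ) : ℕ := ⌈x / ℓ⌉₊ - 1

theorem measurable_blockIndex (ℓ : ℝ) : Measurable (blockIndex ℓ) :=
  (Measurable.of_discrete (f := fun n : ℕ => n - 1)).comp
    (Nat.measurable_ceil.comp (measurable_id.div_const ℓ))

theorem blockIndex_add {ℓ s : ℝ} (hℓ : 0 < ℓ) (hs : 0 < s) (hs' : s ≤ ℓ) (k : ℕ) :
    blockIndex ℓ (ℓ * k + s) = k := by
  have h : ⌈(ℓ * k + s) / ℓ⌉₊ = k + 1 := by
    rw [Nat.ceil_eq_iff (by simp)]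
    have h1 : (ℓ * k + s) / ℓ = k + s / ℓ := by field_simp
    have h2 : 0 < s / ℓ := by positivity
    have h3 : s / ℓ ≤ 1 := (div_le_one hℓ).2 hs'
    rw [h1]
    push_cast
    constructor <;> simp <;> linarith
  rw [blockIndex, h]
  rfl

/-- The service law `ν` is spread evenly over the instants of the block `(0, ℓ]`: the measure
`base` on the positive instants is the sum of the translates of `ν` to the blocks
`(ℓ k, ℓ (k + 1)]`, and it also dominates every other translate of `ν` to the right. -/
structure IsBlockUniform (tm : TimeModel) (ν : Measure ℝ) (ℓ : ℝ) (base : Measure ℝ) : Prop where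
  prob : IsProbabilityMeasure ν
  pos : 0 < ℓ
  mem_instants : ℓ ∈ tm.instants
  ae_mem : ∀ᵐ s ∂ν, 0 < s ∧ s ≤ ℓ ∧ s ∈ tm.instants
  lintegral_base : ∀ f : ℝ → ℝ≥0∞, Measurable f →
    ∫⁻ x, f x ∂base = ∑' k : ℕ, ∫⁻ s, f (ℓ * k + s) ∂ν
  lintegral_add_le : ∀ w ∈ tm.instants, 0 ≤ w → ∀ f : ℝ → ℝ≥0∞, Measurable f →
    ∫⁻ s, f (w + s) ∂ν ≤ ∫⁻ x, f x ∂base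
  /-- The mean block index is exactly linear in the translation, also between multiples of `ℓ`. -/
  integral_blockIndex : ∀ w ∈ tm.instants, 0 ≤ w → ∫ s, (blockIndex ℓ (w + s) : ℝ) ∂ν = w / ℓ

/-- A cost `c`, the negative logarithm of a (sub)probability density with respect to `base`, whose
mean over `W + S` is at most `A + B 𝔼[W]` for every waiting time `W = (X - S₁)⁺` (and for constant
waiting times up to the additional term `K`). -/
structure IsAffineCost (tm : TimeModel) (ν base : Measure ℝ) (c : ℝ → ℝ) (A B K : ℝ) : Prop where
  measurable : Measurable c
  nonneg : ∀ x, 0 ≤ c x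
  lintegral_exp_neg_le : ∫⁻ x, ENNReal.ofReal (Real.exp (-c x)) ∂base ≤ 1
  intercept_nonneg : 0 ≤ A
  slope_nonneg : 0 ≤ B
  const_nonneg : 0 ≤ K
  const_le : ∀ w ∈ tm.instants, 0 ≤ w →
    ∫⁻ s, ENNReal.ofReal (c (w + s)) ∂ν
      ≤ ENNReal.ofReal A + ENNReal.ofReal B * ENNReal.ofReal w + ENNReal.ofReal K
  smeared_le : ∀ x ∈ tm.instants,
    ∫⁻ s, ∫⁻ t, ENNReal.ofReal (c (max (x - s) 0 + t)) ∂ν ∂ν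
      ≤ ENNReal.ofReal A + ENNReal.ofReal B * ∫⁻ s, ENNReal.ofReal (max (x - s) 0) ∂ν

section Converse

variable {tm : TimeModel} {ν base : Measure ℝ} {ℓ : ℝ}

theorem lastDeparture_nonneg_and_mem {a : ℕ → ℝ} (n : ℕ) (ha : ∀ i < n, a i ∈ tm.instants)
    (s : Fin n → ℝ) (hs : ∀ i, 0 ≤ s i ∧ s i ∈ tm.instants) :
    0 ≤ lastDeparture n (departures (fun i _ => a i) n s) ∧
      lastDeparture n (departures (fun i _ => a i) n s) ∈ tm.instants := by
  induction n with
  | zero => exact ⟨le_rfl, tm.zero_mem_instants⟩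
  | succ n ih =>
    have h := ih (fun i hi => ha i (hi.trans n.lt_succ_self)) (Fin.init s) fun i => hs _
    simp only [departures, lastDeparture_snoc]
    exact ⟨add_nonneg (le_max_of_le_right h.1) (hs _).1,
      TimeModel.add_mem_instants (TimeModel.max_mem_instants (ha n n.lt_succ_self) h.2) (hs _).2⟩

theorem IsBlockUniform.ae_pi_mem (hν : IsBlockUniform tm ν ℓ base) (n : ℕ) :
    ∀ᵐ s ∂(Measure.pi fun _ : Fin n => ν), ∀ i, 0 < s i ∧ s i ≤ ℓ ∧ s i ∈ tm.instants := by
  have := hν.prob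
  rw [ae_all_iff]
  intro i
  exact (Measure.tendsto_eval_ae_ae (μ := fun _ : Fin n => ν) (i := i)).eventually hν.ae_mem

theorem IsBlockUniform.ae_lastDeparture (hν : IsBlockUniform tm ν ℓ base) {a : ℕ → ℝ} (n : ℕ)
    (ha : ∀ i < n, a i ∈ tm.instants) :
    ∀ᵐ s ∂(Measure.pi fun _ : Fin n => ν),
      0 ≤ lastDeparture n (departures (fun i _ => a i) n s) ∧
        lastDeparture n (departures (fun i _ => a i) n s) ∈ tm.instants := by
  filter_upwards [hν.ae_pi_mem n] with s hs
  exact lastDeparture_nonneg_and_mem n ha s fun i => ⟨(hs i).1.le, (hs i).2.2⟩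

/-- Given the message, the interdeparture times have, step by step, a conditional law which is
dominated by `base`; so the total mass of the density `exp (-pathCost)` on the (disjoint) decoding
regions of all messages is at most `1`. -/
theorem IsBlockUniform.sum_lintegral_exp_neg_pathCost_le (hν : IsBlockUniform tm ν ℓ base)
    {c : ℝ → ℝ} (hc : Measurable c) (hc1 : ∫⁻ x, ENNReal.ofReal (Real.exp (-c x)) ∂base ≤ 1)
    [SFinite base] {ι : Type*} [Fintype ι] {a : ι → ℕ → ℝ} (n : ℕ)
    (ha : ∀ u, ∀ i < n, a u i ∈ tm.instants)
    {f : ι → (Fin n → ℝ) → ℝ≥0∞} (hf : ∀ u, Measurable (f u)) (hf1 : ∀ d, ∑ u, f u d ≤ 1) :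
    ∑ u, ∫⁻ s, f u (departures (fun i _ => a u i) n s) *
      ENNReal.ofReal (Real.exp (-pathCost c n (departures (fun i _ => a u i) n s)))
        ∂(Measure.pi fun _ : Fin n => ν) ≤ 1 := by
  have := hν.prob
  induction n with
  | zero =>
    simp only [Measure.pi_of_empty (fun _ : Fin 0 => ν) Fin.elim0, departures, pathCost]
    simpa using hf1 Fin.elim0
  | succ n ih =>
    set F : ι → (Fin n → ℝ) → ℝ≥0∞ := fun u d =>
      ∫⁻ x, f u (Fin.snoc (α := fun _ => ℝ) d (lastDeparture n d + x)) *
        ENNReal.ofReal (Real.exp (-c x)) ∂base with hF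
    have hmeas (u : ι) : Measurable fun p : (Fin n → ℝ) × ℝ =>
        f u (Fin.snoc (α := fun _ => ℝ) p.1 (lastDeparture n p.1 + p.2)) *
          ENNReal.ofReal (Real.exp (-c p.2)) := by
      refine Measurable.mul ((hf u).comp ((measurable_fin_snoc n).comp (measurable_fst.prodMk
        (((measurable_lastDeparture n).comp measurable_fst).add measurable_snd)))) ?_
      exact (Real.measurable_exp.comp (hc.comp measurable_snd).neg).ennreal_ofReal
    have hFm (u : ι) : Measurable (F u) := (hmeas u).lintegral_prod_right'
    have hF1 (d : Fin n → ℝ) : ∑ u, F u d ≤ 1 := by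
      have h (u : ι) : Measurable fun x =>
          f u (Fin.snoc (α := fun _ => ℝ) d (lastDeparture n d + x)) *
            ENNReal.ofReal (Real.exp (-c x)) := (hmeas u).comp measurable_prodMk_left
      simp only [hF]
      rw [← lintegral_finsetSum _ fun u _ => h u]
      refine le_trans (lintegral_mono fun x => ?_) hc1
      rw [← Finset.sum_mul]
      exact mul_le_of_le_one_left' (hf1 _)
    refine le_trans (Finset.sum_le_sum fun u _ => ?_)
      (ih (fun u i hi => ha u i (hi.trans n.lt_succ_self)) hFm hF1)
    have hdep := measurable_departures (enc := fun i (_ : Fin i → ℝ) => a u i)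
      fun i => measurable_const
    rw [lintegral_pi_snoc]
    · refine lintegral_mono_ae ?_
      filter_upwards [hν.ae_lastDeparture n fun i hi => ha u i (hi.trans n.lt_succ_self)] with s hs
      simp only [departures_snoc, pathCost_snoc]
      set d := departures (fun i _ => a u i) n s
      set w := max (a u n) (lastDeparture n d) - lastDeparture n d with hw
      have h0 : 0 ≤ w := sub_nonneg.2 (le_max_right _ _)
      have hmem : w ∈ tm.instants := TimeModel.sub_mem_instants
        (TimeModel.max_mem_instants (ha u n n.lt_succ_self) hs.2) hs.2
      have hm1 : Measurable fun x =>
          f u (Fin.snoc (α := fun _ => ℝ) d (lastDeparture n d + x)) *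
            ENNReal.ofReal (Real.exp (-c x)) := (hmeas u).comp measurable_prodMk_left
      refine le_trans (le_of_eq ?_) (mul_le_mul_left (hν.lintegral_add_le w hmem h0 _ hm1) _)
      have hm2 : Measurable fun t =>
          f u (Fin.snoc (α := fun _ => ℝ) d (lastDeparture n d + (w + t))) *
            ENNReal.ofReal (Real.exp (-c (w + t))) := hm1.comp (measurable_const_add w)
      rw [← lintegral_mul_const _ hm2]
      refine lintegral_congr fun t => ?_
      have h1 : max (a u n) (lastDeparture n d) + t - lastDeparture n d = w + t := by
        rw [hw]; ring
      have h2 : lastDeparture n d + (w + t) = max (a u n) (lastDeparture n d) + t := by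
        rw [hw]; ring
      simp only [h1, h2]
      rw [neg_add, Real.exp_add, ENNReal.ofReal_mul (Real.exp_nonneg _)]
      ring
    · exact ((hf u).comp (hdep (n + 1))).mul (Real.measurable_exp.comp
        ((measurable_pathCost hc (n + 1)).comp (hdep (n + 1))).neg).ennreal_ofReal

/-- The mean cost of the interdeparture times is controlled by the total `W` of the mean waiting
times, because without feedback the waiting time of a packet is `(X - S₁)⁺` with `X` independent of
the service time `S₁` of the packet before it. -/
theorem IsBlockUniform.exists_lintegral_pathCost_le (hν : IsBlockUniform tm ν ℓ base)
    {c : ℝ → ℝ} {A B K : ℝ} (hc : IsAffineCost tm ν base c A B K) {a : ℕ → ℝ} (n : ℕ)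
    (ha : ∀ i < n, 0 ≤ a i ∧ a i ∈ tm.instants) :
    ∃ W : ℝ≥0∞,
      ∫⁻ s, ENNReal.ofReal (pathCost c n (departures (fun i _ => a i) n s))
          ∂(Measure.pi fun _ : Fin n => ν)
        ≤ n * ENNReal.ofReal A + ENNReal.ofReal B * W + ENNReal.ofReal K ∧
      W + n * ∫⁻ s, ENNReal.ofReal s ∂ν =
        ∫⁻ s, ENNReal.ofReal (lastDeparture n (departures (fun i _ => a i) n s))
          ∂(Measure.pi fun _ : Fin n => ν) := by
  have := hν.prob
  have hdep := measurable_departures (enc := fun i (_ : Fin i → ℝ) => a i)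
      fun i => measurable_const
  have hcm := hc.measurable
  induction n with
  | zero => exact ⟨0, by simp [pathCost], by simp [lastDeparture]⟩
  | succ n ih =>
    obtain ⟨W, hW, hW'⟩ := ih fun i hi => ha i (hi.trans n.lt_succ_self)
    set w : (Fin n → ℝ) → ℝ := fun s =>
      max (a n) (lastDeparture n (departures (fun i _ => a i) n s)) -
        lastDeparture n (departures (fun i _ => a i) n s) with hw
    have hlast : Measurable fun s => lastDeparture n (departures (fun i _ => a i) n s) :=
      (measurable_lastDeparture n).comp (hdep n)
    have hwm : Measurable w := (measurable_const.max hlast).sub hlast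
    have hw0 (s) : 0 ≤ w s := sub_nonneg.2 (le_max_right _ _)
    -- The first packet finds an idle server at time `0`, so its waiting time is a constant.
    have hcost : ∫⁻ s, ∫⁻ t, ENNReal.ofReal (c (w s + t)) ∂ν ∂(Measure.pi fun _ : Fin n => ν) ≤
        ENNReal.ofReal A + ENNReal.ofReal B * ∫⁻ s, ENNReal.ofReal (w s)
          ∂(Measure.pi fun _ : Fin n => ν) + if n = 0 then ENNReal.ofReal K else 0 := by
      cases n with
      | zero =>
        have h := ha 0 zero_lt_one
        simp only [Measure.pi_of_empty (fun _ : Fin 0 => ν) Fin.elim0, lintegral_dirac, if_true]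
        have hw1 : w Fin.elim0 = a 0 := by simp [hw, lastDeparture, h.1]
        rw [hw1]
        exact hc.const_le _ h.2 h.1
      | succ m =>
        have hcm2 : Measurable fun s => ∫⁻ t, ENNReal.ofReal (c (w s + t)) ∂ν :=
          Measurable.lintegral_prod_right' (f := fun p : (Fin (m + 1) → ℝ) × ℝ =>
            ENNReal.ofReal (c (w p.1 + p.2)))
            (hcm.comp ((hwm.comp measurable_fst).add measurable_snd)).ennreal_ofReal
        rw [lintegral_pi_snoc _ _ hcm2, lintegral_pi_snoc _ _ hwm.ennreal_ofReal]
        simp only [Nat.add_eq_zero_iff, one_ne_zero, and_false, if_false, add_zero]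
        have key : ∀ᵐ s ∂(Measure.pi fun _ : Fin m => ν),
            ∫⁻ t', ∫⁻ t, ENNReal.ofReal (c (w (Fin.snoc (α := fun _ => ℝ) s t') + t)) ∂ν ∂ν ≤
            ENNReal.ofReal A + ENNReal.ofReal B *
              ∫⁻ t', ENNReal.ofReal (w (Fin.snoc (α := fun _ => ℝ) s t')) ∂ν := by
          filter_upwards [hν.ae_lastDeparture m fun i hi => (ha i (by omega)).2] with s hs
          -- Packet `m` starts its service at the instant `y`, which its service time `t'` does not
          -- affect.
          set y := max (a m) (lastDeparture m (departures (fun i _ => a i) m s)) with hy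
          have hwy (t' : ℝ) : w (Fin.snoc (α := fun _ => ℝ) s t') = max (a (m + 1) - y - t') 0 := by
            simp only [hw, departures_snoc, lastDeparture_snoc, ← hy]
            rw [max_sub_sub_right (a (m + 1)) (y + t') (y + t') |>.symm]
            congr 1 <;> ring
          simp only [hwy]
          exact hc.smeared_le _ (TimeModel.sub_mem_instants (ha _ (by omega)).2
            (TimeModel.max_mem_instants (ha m (by omega)).2 hs.2))
        refine (lintegral_mono_ae key).trans (le_of_eq ?_)
        have hm3 : Measurable fun s : Fin m → ℝ =>
            ∫⁻ t', ENNReal.ofReal (w (Fin.snoc (α := fun _ => ℝ) s t')) ∂ν :=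
          Measurable.lintegral_prod_right' (f := fun p : (Fin m → ℝ) × ℝ =>
            ENNReal.ofReal (w (Fin.snoc (α := fun _ => ℝ) p.1 p.2)))
            (hwm.comp (measurable_fin_snoc m)).ennreal_ofReal
        rw [lintegral_add_left measurable_const, lintegral_const_mul _ hm3]
        simp
    refine ⟨W + ∫⁻ s, ENNReal.ofReal (w s) ∂(Measure.pi fun _ : Fin n => ν), ?_, ?_⟩
    · have h1 : ∫⁻ s, ENNReal.ofReal (pathCost c (n + 1) (departures (fun i _ => a i) (n + 1) s))
          ∂(Measure.pi fun _ : Fin (n + 1) => ν) =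
          ∫⁻ s, ENNReal.ofReal (pathCost c n (departures (fun i _ => a i) n s))
          ∂(Measure.pi fun _ : Fin n => ν) +
          ∫⁻ s, ∫⁻ t, ENNReal.ofReal (c (w s + t)) ∂ν ∂(Measure.pi fun _ : Fin n => ν) := by
        have hm (n : ℕ) : Measurable fun s =>
            ENNReal.ofReal (pathCost c n (departures (fun i _ => a i) n s)) :=
          ((measurable_pathCost hcm n).comp (hdep n)).ennreal_ofReal
        rw [lintegral_pi_snoc _ _ (hm (n + 1)), ← lintegral_add_left (hm n)]
        refine lintegral_congr fun s => ?_
        simp only [departures_snoc, pathCost_snoc]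
        have h2 (t : ℝ) : max (a n) (lastDeparture n (departures (fun i _ => a i) n s)) + t -
            lastDeparture n (departures (fun i _ => a i) n s) = w s + t := by
          rw [hw]; ring
        simp only [h2, ENNReal.ofReal_add (pathCost_nonneg hc.nonneg n _) (hc.nonneg _)]
        rw [lintegral_add_left measurable_const]
        simp
      rw [h1]
      rcases Nat.eq_zero_or_pos n with rfl | hn
      · have h3 : ∫⁻ s, ENNReal.ofReal (pathCost c 0 (departures (fun i _ => a i) 0 s))
            ∂(Measure.pi fun _ : Fin 0 => ν) = 0 := by simp [pathCost]
        rw [h3, zero_add]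
        refine hcost.trans ?_
        simp only [if_true, zero_add, Nat.cast_one, one_mul]
        gcongr
        exact le_add_self
      · rw [if_neg hn.ne', add_zero] at hcost
        refine (add_le_add hW hcost).trans (le_of_eq ?_)
        push_cast
        ring
    · have hm : Measurable fun s => ENNReal.ofReal (lastDeparture (n + 1)
          (departures (fun i _ => a i) (n + 1) s)) :=
        ((measurable_lastDeparture (n + 1)).comp (hdep (n + 1))).ennreal_ofReal
      rw [lintegral_pi_snoc _ _ hm]
      have h1 : ∫⁻ s, ∫⁻ t, ENNReal.ofReal (lastDeparture (n + 1)
            (departures (fun i _ => a i) (n + 1) (Fin.snoc (α := fun _ => ℝ) s t))) ∂ν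
            ∂(Measure.pi fun _ : Fin n => ν) =
          ∫⁻ s, (ENNReal.ofReal (lastDeparture n (departures (fun i _ => a i) n s)) +
            ENNReal.ofReal (w s) + ∫⁻ t, ENNReal.ofReal t ∂ν)
            ∂(Measure.pi fun _ : Fin n => ν) := by
        refine lintegral_congr_ae ?_
        filter_upwards [hν.ae_lastDeparture n fun i hi => (ha i (by omega)).2] with s hs
        rw [← ENNReal.ofReal_add hs.1 (hw0 s)]
        have h2 : ∫⁻ t, ENNReal.ofReal (lastDeparture (n + 1)
            (departures (fun i _ => a i) (n + 1) (Fin.snoc (α := fun _ => ℝ) s t))) ∂ν =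
            ∫⁻ t, (ENNReal.ofReal (lastDeparture n (departures (fun i _ => a i) n s) + w s) +
              ENNReal.ofReal t) ∂ν := by
          refine lintegral_congr_ae ?_
          filter_upwards [hν.ae_mem] with t ht
          rw [← ENNReal.ofReal_add (add_nonneg hs.1 (hw0 s)) ht.1.le, departures_snoc,
            lastDeparture_snoc, hw]
          congr 1
          ring
        rw [h2, lintegral_add_left measurable_const]
        simp
      rw [h1, lintegral_add_right _ measurable_const,
        lintegral_add_right _ hwm.ennreal_ofReal, ← hW']
      simp only [lintegral_const, measure_univ, mul_one]
      push_cast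
      ring

end Converse

/-! ### The converse without feedback -/

section Converse

variable {tm : TimeModel} {ν base : Measure ℝ} {ℓ : ℝ}

theorem IsBlockUniform.integrable_id (hν : IsBlockUniform tm ν ℓ base) :
    Integrable (fun s : ℝ => s) ν := by
  have := hν.prob
  refine Integrable.of_bound measurable_id.aestronglyMeasurable ℓ ?_
  filter_upwards [hν.ae_mem] with s hs
  rw [Real.norm_eq_abs, abs_of_pos hs.1]
  exact hs.2.1

theorem IsBlockUniform.lintegral_id (hν : IsBlockUniform tm ν ℓ base) :
    ∫⁻ s, ENNReal.ofReal s ∂ν = ENNReal.ofReal (∫ s, s ∂ν) := by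
  rw [ofReal_integral_eq_lintegral_ofReal hν.integrable_id]
  filter_upwards [hν.ae_mem] with s hs using hs.1.le

theorem IsBlockUniform.mean_pos (hν : IsBlockUniform tm ν ℓ base) : 0 < ∫ s, s ∂ν := by
  have := hν.prob
  refine (integral_pos_iff_support_of_nonneg_ae ?_ hν.integrable_id).2 ?_
  · filter_upwards [hν.ae_mem] with s hs using hs.1.le
  · have h : Function.support (fun s : ℝ => s) =ᵐ[ν] Set.univ := by
      rw [eventuallyEq_univ]
      filter_upwards [hν.ae_mem] with s hs using hs.1.ne'
    rw [measure_congr h]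
    simp

/-- The converse for a single code. With the reference density `r = exp (-pathCost)`, one has
`log M ≤ -log r + M r` pointwise. On integrating this over the decoding region of each message and
averaging over the messages, the first term becomes at most the mean cost, because the cost is
nonnegative, and the second one at most `1`, because the decoding regions are disjoint. -/
theorem IsBlockUniform.one_sub_mul_log_le (hν : IsBlockUniform tm ν ℓ base) [SFinite base]
    {c : ℝ → ℝ} {A B K : ℝ} (hc : IsAffineCost tm ν base c A B K) {n M : ℕ} {T ε e : ℝ}
    (C : TimingCode tm ν false n M T ε) (hT : 0 ≤ T) (he : ε ≤ e) (he0 : 0 ≤ e) :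
    (1 - e) * Real.log M ≤ n * A + B * (T - n * ∫ s, s ∂ν) + K + 1 := by
  have := hν.prob
  have hM : 0 < M := (Nat.zero_le _).trans_lt (C.dec fun _ => 0).isLt
  set a : Fin M → ℕ → ℝ := fun u i => C.enc u i fun _ => 0 with ha
  set μ := Measure.pi fun _ : Fin n => ν with hμ
  set dep : Fin M → (Fin n → ℝ) → (Fin n → ℝ) := fun u => departures (fun i _ => a u i) n with hdep
  have henc (u) : departures (C.enc u) n = dep u := by
    rw [hdep, ha, C.enc_eq_const u]
  have hdm (u) : Measurable (dep u) := measurable_departures (fun i => measurable_const) n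
  have ha' (u : Fin M) (i : ℕ) (hi : i < n) : 0 ≤ a u i ∧ a u i ∈ tm.instants := by
    obtain ⟨s, hs⟩ := (C.admissible u).exists
    have h := hs.1 ⟨i, hi⟩
    rwa [arrivals, C.enc_eq_const u] at h
  set G : Fin M → Set (Fin n → ℝ) := fun u => C.dec ⁻¹' {u} with hG
  have hGm (u) : MeasurableSet (G u) := C.measurable_dec (measurableSet_singleton u)
  have hpm (u) : Measurable fun s => pathCost c n (dep u s) :=
    (measurable_pathCost hc.measurable n).comp (hdm u)
  set f : Fin M → (Fin n → ℝ) → ℝ≥0∞ := fun u d => if C.dec d = u then 1 else 0 with hf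
  have hfm (u) : Measurable (f u) := Measurable.ite (hGm u) measurable_const measurable_const
  have hfdm (u) : Measurable fun s => f u (dep u s) := (hfm u).comp (hdm u)
  have h1 : ∑ u, ∫⁻ s, f u (dep u s) * ENNReal.ofReal (Real.exp (-pathCost c n (dep u s))) ∂μ
      ≤ 1 := by
    refine hν.sum_lintegral_exp_neg_pathCost_le hc.measurable hc.lintegral_exp_neg_le n
      (fun u i hi => (ha' u i hi).2) hfm fun d => ?_
    simp [hf]
  choose W hW hW' using fun u => hν.exists_lintegral_pathCost_le hc n (ha' u)
  have hlogM : 0 ≤ Real.log M := Real.log_natCast_nonneg M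
  -- On the decoding region this is `log (M r) ≤ M r - 1`.
  have hpt (u : Fin M) (s : Fin n → ℝ) : ENNReal.ofReal (Real.log M) * f u (dep u s) ≤
      ENNReal.ofReal (pathCost c n (dep u s)) +
        M * (f u (dep u s) * ENNReal.ofReal (Real.exp (-pathCost c n (dep u s)))) := by
    by_cases hs : C.dec (dep u s) = u
    · have h := Real.log_le_sub_one_of_pos
        (show 0 < M * Real.exp (-pathCost c n (dep u s)) by positivity)
      rw [Real.log_mul (by positivity) (Real.exp_ne_zero _), Real.log_exp] at h
      have h' : f u (dep u s) = 1 := by simp [hf, hs]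
      rw [h', one_mul, mul_one, ← ENNReal.ofReal_natCast M, ← ENNReal.ofReal_mul (Nat.cast_nonneg _),
        ← ENNReal.ofReal_add (pathCost_nonneg hc.nonneg n _) (by positivity)]
      exact ENNReal.ofReal_le_ofReal (by linarith)
    · simp [hf, hs]
  have hgood (u : Fin M) : ∫⁻ s, f u (dep u s) ∂μ + μ {s | C.dec (dep u s) ≠ u} = 1 := by
    have h2 : (fun s => f u (dep u s)) = (dep u ⁻¹' G u).indicator 1 := by
      ext s
      by_cases h : C.dec (dep u s) = u
      · rw [Set.indicator_of_mem (show s ∈ dep u ⁻¹' G u from h)]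
        simp [hf, h]
      · rw [Set.indicator_of_notMem (show s ∉ dep u ⁻¹' G u from h)]
        simp [hf, h]
    rw [h2, lintegral_indicator_one (hdm u (hGm u))]
    exact prob_add_prob_compl (hdm u (hGm u))
  have hbad : ∑ u, μ {s | C.dec (dep u s) ≠ u} ≤ M * ENNReal.ofReal e := by
    have h := C.error
    simp only [henc] at h
    rw [ENNReal.div_le_iff_le_mul (by simp [hM.ne']) (by simp)] at h
    refine h.trans ?_
    rw [mul_comm]
    gcongr
  have hM1 : (M : ℝ≥0∞) ≤ ∑ u, ∫⁻ s, f u (dep u s) ∂μ + M * ENNReal.ofReal e := by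
    calc (M : ℝ≥0∞) = ∑ u : Fin M, 1 := by simp
      _ = ∑ u, ∫⁻ s, f u (dep u s) ∂μ + ∑ u, μ {s | C.dec (dep u s) ≠ u} := by
        rw [← Finset.sum_add_distrib]
        exact Finset.sum_congr rfl fun u _ => (hgood u).symm
      _ ≤ _ := by gcongr
  have hlog : ENNReal.ofReal (Real.log M) * ∑ u, ∫⁻ s, f u (dep u s) ∂μ ≤
      ∑ u, ∫⁻ s, ENNReal.ofReal (pathCost c n (dep u s)) ∂μ + M := by
    have h3 (u : Fin M) : ENNReal.ofReal (Real.log M) * ∫⁻ s, f u (dep u s) ∂μ ≤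
        ∫⁻ s, ENNReal.ofReal (pathCost c n (dep u s)) ∂μ + M *
        ∫⁻ s, f u (dep u s) * ENNReal.ofReal (Real.exp (-pathCost c n (dep u s))) ∂μ := by
      have h4 : Measurable fun s => f u (dep u s) *
          ENNReal.ofReal (Real.exp (-pathCost c n (dep u s))) :=
        (hfdm u).mul (Real.measurable_exp.comp (hpm u).neg).ennreal_ofReal
      rw [← lintegral_const_mul _ (hfdm u), ← lintegral_const_mul _ h4,
        ← lintegral_add_left (hpm u).ennreal_ofReal]
      exact lintegral_mono (hpt u)
    rw [Finset.mul_sum]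
    refine (Finset.sum_le_sum fun u _ => h3 u).trans ?_
    rw [Finset.sum_add_distrib, ← Finset.mul_sum]
    gcongr
    exact mul_le_of_le_one_right' h1
  have hcost : ∑ u, ∫⁻ s, ENNReal.ofReal (pathCost c n (dep u s)) ∂μ ≤
      M * (n * ENNReal.ofReal A) + ENNReal.ofReal B * ∑ u, W u + M * ENNReal.ofReal K := by
    refine (Finset.sum_le_sum fun u _ => hW u).trans (le_of_eq ?_)
    rw [Finset.sum_add_distrib, Finset.sum_add_distrib, Finset.mul_sum]
    simp
  have htime : ∑ u, W u + M * (n * ENNReal.ofReal (∫ s, s ∂ν)) ≤ M * ENNReal.ofReal T := by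
    have h := C.deadline
    simp only [henc] at h
    rw [ENNReal.div_le_iff_le_mul (by simp [hM.ne']) (by simp)] at h
    rw [mul_comm (M : ℝ≥0∞) (ENNReal.ofReal T)]
    refine le_trans (le_of_eq ?_) h
    rw [← hν.lintegral_id, ← Finset.sum_congr rfl fun u _ => hW' u, Finset.sum_add_distrib]
    simp
  obtain ⟨ω, hω0, hω⟩ : ∃ ω : ℝ, 0 ≤ ω ∧ ∑ u, W u = ENNReal.ofReal ω := by
    refine ⟨(∑ u, W u).toReal, ENNReal.toReal_nonneg, (ENNReal.ofReal_toReal ?_).symm⟩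
    exact ne_top_of_le_ne_top (ENNReal.mul_ne_top (by simp) (by simp)) (le_self_add.trans htime)
  have hfinal : ENNReal.ofReal (Real.log M) * M ≤
      M * (n * ENNReal.ofReal A) + ENNReal.ofReal B * ENNReal.ofReal ω + M * ENNReal.ofReal K + M +
        ENNReal.ofReal (Real.log M) * (M * ENNReal.ofReal e) := by
    rw [← hω]
    calc ENNReal.ofReal (Real.log M) * M
        ≤ ENNReal.ofReal (Real.log M) * (∑ u, ∫⁻ s, f u (dep u s) ∂μ + M * ENNReal.ofReal e) := by
          gcongr
      _ ≤ _ := by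
          rw [mul_add]
          gcongr
          exact hlog.trans (by gcongr)
  have hσ := hν.mean_pos
  have hA := hc.intercept_nonneg
  have hB := hc.slope_nonneg
  have hK := hc.const_nonneg
  rw [hω] at htime
  rw [← ENNReal.ofReal_natCast M, ← ENNReal.ofReal_natCast n] at htime hfinal
  repeat rw [← ENNReal.ofReal_mul (by positivity)] at htime
  repeat rw [← ENNReal.ofReal_mul (by positivity)] at hfinal
  repeat rw [← ENNReal.ofReal_add (by positivity) (by positivity)] at htime
  repeat rw [← ENNReal.ofReal_add (by positivity) (by positivity)] at hfinal
  rw [ENNReal.ofReal_le_ofReal_iff (by positivity)] at htime hfinal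
  have hM' : (0 : ℝ) < M := Nat.cast_pos.2 hM
  have h5 := mul_le_mul_of_nonneg_left htime hB
  refine le_of_mul_le_mul_left ?_ hM'
  linarith

/-- Codes without feedback carry, up to a constant, at most `A` nats per packet plus `B` nats per
unit of time. -/
def HasConverseBound (tm : TimeModel) (ν : Measure ℝ) (A B : ℝ) : Prop :=
  ∃ K : ℝ, ∀ (n M : ℕ) (T ε e : ℝ), Nonempty (TimingCode tm ν false n M T ε) → 0 ≤ T → ε ≤ e →
    0 ≤ e → (1 - e) * Real.log M ≤ n * A + B * T + K

theorem IsBlockUniform.hasConverseBound (hν : IsBlockUniform tm ν ℓ base) [SFinite base]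
    {c : ℝ → ℝ} {A B K : ℝ} (hc : IsAffineCost tm ν base c A B K) :
    HasConverseBound tm ν (A - B * ∫ s, s ∂ν) B := by
  refine ⟨K + 1, ?_⟩
  rintro n M T ε e ⟨C⟩ hT he he0
  have := hν.one_sub_mul_log_le hc C hT he he0
  linarith

theorem HasConverseBound.convexCombination {A₁ B₁ A₂ B₂ t : ℝ} (h₁ : HasConverseBound tm ν A₁ B₁)
    (h₂ : HasConverseBound tm ν A₂ B₂) (ht : 0 ≤ t) (ht' : t ≤ 1) :
    HasConverseBound tm ν ((1 - t) * A₁ + t * A₂) ((1 - t) * B₁ + t * B₂) := by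
  obtain ⟨K₁, h₁⟩ := h₁
  obtain ⟨K₂, h₂⟩ := h₂
  refine ⟨(1 - t) * K₁ + t * K₂, fun n M T ε e C hT he he0 => ?_⟩
  have h3 := mul_le_mul_of_nonneg_left (h₁ n M T ε e C hT he he0) (sub_nonneg.2 ht')
  have h4 := mul_le_mul_of_nonneg_left (h₂ n M T ε e C hT he he0) ht
  linarith

theorem HasConverseBound.mul_log_two_le {A B D R γ : ℝ} (h : HasConverseBound tm ν A B)
    {n M : ℕ → ℕ} {T ε : ℕ → ℝ} (hT : Tendsto T atTop atTop) (hε : Tendsto ε atTop (𝓝 0))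
    (hC : ∀ k, Nonempty (TimingCode tm ν false (n k) (M k) (T k) (ε k)))
    (hR : ∀ k, R - γ < Real.logb 2 (M k) / T k) (hD : ∀ k, n k * A + B * T k ≤ D * T k) :
    (R - γ) * Real.log 2 ≤ D := by
  obtain ⟨K, h⟩ := h
  have hl2 := Real.log_pos one_lt_two
  have h1 : Tendsto (fun k => (1 - max (ε k) 0) * ((R - γ) * Real.log 2)) atTop
      (𝓝 ((1 - max 0 0) * ((R - γ) * Real.log 2))) :=
    (tendsto_const_nhds.sub (hε.max tendsto_const_nhds)).mul_const _
  have h2 : Tendsto (fun k => D + K / T k) atTop (𝓝 (D + 0)) :=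
    tendsto_const_nhds.add (hT.const_div_atTop K)
  rw [max_self, sub_zero, one_mul] at h1
  rw [add_zero] at h2
  refine le_of_tendsto_of_tendsto h1 h2 ?_
  filter_upwards [hT.eventually_gt_atTop 0, hε.eventually_lt_const one_pos] with k hTk hεk
  have h3 := h (n k) (M k) (T k) (ε k) (max (ε k) 0) (hC k) hTk.le (le_max_left _ _)
    (le_max_right _ _)
  have h4 := hR k
  rw [Real.logb, div_div, lt_div_iff₀ (by positivity)] at h4
  have h5 : 0 ≤ 1 - max (ε k) 0 := sub_nonneg.2 (max_le hεk.le zero_le_one)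
  have h6 := mul_le_mul_of_nonneg_left h4.le h5
  have h7 := hD k
  rw [← mul_le_mul_iff_of_pos_right hTk, add_mul, div_mul_cancel₀ _ hTk.ne']
  linarith

theorem capacity_le_of_hasConverseBound {A B : ℝ} (h : HasConverseBound tm ν A B) (hA : A ≤ 0) :
    capacity tm ν false ≤ ((B / Real.log 2 : ℝ) : EReal) := by
  refine iSup₂_le fun R hR => EReal.coe_le_coe_iff.2 (le_of_forall_pos_le_add fun γ hγ => ?_)
  obtain ⟨n, M, T, ε, hT, hε, hC⟩ := hR γ hγ
  have h1 := h.mul_log_two_le hT hε (fun k => (hC k).1) (fun k => (hC k).2) (D := B) fun k =>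
    add_le_of_nonpos_left (mul_nonpos_of_nonneg_of_nonpos (Nat.cast_nonneg _) hA)
  rw [← le_div_iff₀ (Real.log_pos one_lt_two)] at h1
  linarith

theorem capacityAt_le_of_hasConverseBound {A B lam : ℝ} (h : HasConverseBound tm ν A B)
    (hlam : 0 < lam) :
    capacityAt tm ν false lam ≤ (((lam * A + B) / Real.log 2 : ℝ) : EReal) := by
  refine iSup₂_le fun R hR => EReal.coe_le_coe_iff.2 (le_of_forall_pos_le_add fun γ hγ => ?_)
  obtain ⟨n, M, ε, hn, hε, hC⟩ := hR γ hγ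
  have h1 := h.mul_log_two_le (D := lam * A + B) (R := R) (γ := γ)
    ((tendsto_natCast_atTop_atTop.comp hn).atTop_div_const hlam) hε (fun k => (hC k).1)
    (fun k => (hC k).2.trans_eq ?_) fun k => ?_
  · rw [← le_div_iff₀ (Real.log_pos one_lt_two)] at h1
    linarith
  · simp only [Function.comp]
    rw [div_div_eq_mul_div]
    ring
  · simp only [Function.comp]
    field_simp
    exact le_of_eq (by ring)

end Converse

/-! ### A zero-error code with feedback -/

/-- The encoder that makes packet `i` find the server idle for the time `ℓ * g i`: a packet which
is not to wait is sent together with the packet before it, so that it queues, and the other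
packets are sent the time `ℓ * g i` after the preceding departure has been observed. -/
noncomputable def feedbackEnc (ℓ : ℝ) (g : ℕ → ℕ) : (i : ℕ) → (Fin i → ℝ) → ℝ
  | 0, _ => ℓ * g 0
  | i + 1, h => if g (i + 1) = 0 then feedbackEnc ℓ g i (Fin.init h)
      else h (Fin.last i) + ℓ * g (i + 1)

theorem measurable_feedbackEnc (ℓ : ℝ) (g : ℕ → ℕ) (i : ℕ) : Measurable (feedbackEnc ℓ g i) := by
  induction i with
  | zero => exact measurable_const
  | succ i ih =>
    change Measurable fun h : Fin (i + 1) → ℝ => if g (i + 1) = 0 then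
      feedbackEnc ℓ g i (Fin.init h) else h (Fin.last i) + ℓ * g (i + 1)
    split_ifs
    · exact ih.comp (measurable_fin_init i)
    · exact (measurable_pi_apply _).add_const _

theorem feedbackEnc_causal {ℓ : ℝ} (hℓ : 0 < ℓ) (g : ℕ → ℕ) (i : ℕ) (h h' : Fin i → ℝ)
    (hh : ∀ k, h k < feedbackEnc ℓ g i h ∨ h' k < feedbackEnc ℓ g i h → h' k = h k) :
    feedbackEnc ℓ g i h' = feedbackEnc ℓ g i h := by
  induction i with
  | zero => rfl
  | succ i ih =>
    unfold feedbackEnc at hh ⊢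
    split_ifs at hh ⊢ with hg
    · exact ih _ _ fun k hk => hh k.castSucc hk
    · have : 0 < ℓ * g (i + 1) := mul_pos hℓ (Nat.cast_pos.2 (Nat.pos_of_ne_zero hg))
      rw [hh (Fin.last i) (Or.inl (by linarith))]

theorem departures_castLE (enc : (i : ℕ) → (Fin i → ℝ) → ℝ) {i n : ℕ} (hi : i ≤ n)
    (s : Fin n → ℝ) :
    (fun k : Fin i => departures enc n s (k.castLE hi)) =
      departures enc i fun k => s (k.castLE hi) := by
  induction n with
  | zero =>
    obtain rfl := Nat.le_zero.1 hi
    rfl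
  | succ n ih =>
    rcases hi.eq_or_lt with rfl | h
    · rfl
    · rw [← Fin.snoc_init_self (α := fun _ => ℝ) s, departures_snoc]
      have h1 (k : Fin i) : k.castLE hi = (k.castLE (Nat.lt_succ_iff.1 h)).castSucc := rfl
      simp only [h1, Fin.snoc_castSucc]
      exact ih _ _

section Feedback

variable {tm : TimeModel} {ν base : Measure ℝ} {ℓ : ℝ}

/-- The departure instants of the first `n` packets under `feedbackEnc`, for an infinite sequence of
service times. -/
noncomputable def feedbackPath (ℓ : ℝ) (g : ℕ → ℕ) (s : ℕ → ℝ) (n : ℕ) : Fin n → ℝ :=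
  departures (feedbackEnc ℓ g) n fun k => s k

theorem feedbackPath_succ (ℓ : ℝ) (g : ℕ → ℕ) (s : ℕ → ℝ) (n : ℕ) :
    feedbackPath ℓ g s (n + 1) = Fin.snoc (α := fun _ => ℝ) (feedbackPath ℓ g s n)
      (max (feedbackEnc ℓ g n (feedbackPath ℓ g s n)) (lastDeparture n (feedbackPath ℓ g s n))
        + s n) := rfl

theorem feedbackEnc_feedbackPath_succ (ℓ : ℝ) (g : ℕ → ℕ) (s : ℕ → ℝ) (n : ℕ) :
    feedbackEnc ℓ g (n + 1) (feedbackPath ℓ g s (n + 1)) =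
      if g (n + 1) = 0 then feedbackEnc ℓ g n (feedbackPath ℓ g s n)
      else lastDeparture (n + 1) (feedbackPath ℓ g s (n + 1)) + ℓ * g (n + 1) := by
  rw [feedbackEnc, feedbackPath_succ, Fin.init_snoc]
  rfl

theorem feedbackEnc_le_lastDeparture {ℓ : ℝ} {g : ℕ → ℕ} {s : ℕ → ℝ} (hs : ∀ i, 0 < s i) (n : ℕ) :
    feedbackEnc ℓ g n (feedbackPath ℓ g s n) ≤
      lastDeparture (n + 1) (feedbackPath ℓ g s (n + 1)) := by
  rw [feedbackPath_succ, lastDeparture_snoc]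
  have := le_max_left (feedbackEnc ℓ g n (feedbackPath ℓ g s n))
    (lastDeparture n (feedbackPath ℓ g s n))
  linarith [hs n]

theorem lastDeparture_feedbackPath_succ {ℓ : ℝ} (hℓ : 0 < ℓ) {g : ℕ → ℕ} {s : ℕ → ℝ}
    (hs : ∀ i, 0 < s i) (n : ℕ) :
    lastDeparture (n + 1) (feedbackPath ℓ g s (n + 1)) =
      lastDeparture n (feedbackPath ℓ g s n) + (ℓ * g n + s n) := by
  rw [feedbackPath_succ, lastDeparture_snoc, ← add_assoc]
  congr 1
  have h0 (i : ℕ) : 0 ≤ ℓ * g i := mul_nonneg hℓ.le (Nat.cast_nonneg _)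
  cases n with
  | zero =>
    simp only [feedbackEnc, lastDeparture, zero_add]
    exact max_eq_left (h0 0)
  | succ n =>
    rw [feedbackEnc_feedbackPath_succ]
    split_ifs with hg
    · rw [max_eq_right (feedbackEnc_le_lastDeparture hs n), hg]
      simp
    · exact max_eq_left (by linarith [h0 (n + 1)])

theorem lastDeparture_feedbackPath {ℓ : ℝ} (hℓ : 0 < ℓ) {g : ℕ → ℕ} {s : ℕ → ℝ}
    (hs : ∀ i, 0 < s i) (n : ℕ) :
    lastDeparture n (feedbackPath ℓ g s n) = ∑ i ∈ Finset.range n, (ℓ * g i + s i) := by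
  induction n with
  | zero => rfl
  | succ n ih => rw [lastDeparture_feedbackPath_succ hℓ hs, ih, Finset.sum_range_succ]

theorem monotone_feedbackEnc_feedbackPath {ℓ : ℝ} (hℓ : 0 < ℓ) {g : ℕ → ℕ} {s : ℕ → ℝ}
    (hs : ∀ i, 0 < s i) : Monotone fun i => feedbackEnc ℓ g i (feedbackPath ℓ g s i) := by
  refine monotone_nat_of_le_succ fun n => ?_
  rw [feedbackEnc_feedbackPath_succ]
  split_ifs
  · exact le_rfl
  · have := feedbackEnc_le_lastDeparture (ℓ := ℓ) (g := g) hs n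
    have h0 : 0 ≤ ℓ * g (n + 1) := mul_nonneg hℓ.le (Nat.cast_nonneg _)
    linarith

theorem feedbackEnc_feedbackPath_mem_instants {ℓ : ℝ} (hℓ : 0 < ℓ) (hℓ' : ℓ ∈ tm.instants)
    {g : ℕ → ℕ} {s : ℕ → ℝ} (hs : ∀ i, 0 < s i) (hs' : ∀ i, s i ∈ tm.instants) (n : ℕ) :
    feedbackEnc ℓ g n (feedbackPath ℓ g s n) ∈ tm.instants := by
  have h (n : ℕ) : lastDeparture n (feedbackPath ℓ g s n) ∈ tm.instants := by
    induction n with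
    | zero => exact tm.zero_mem_instants
    | succ n ih =>
      rw [lastDeparture_feedbackPath_succ hℓ hs]
      exact TimeModel.add_mem_instants ih (TimeModel.add_mem_instants
        (TimeModel.natCast_mul_mem_instants hℓ' _) (hs' n))
  induction n with
  | zero => exact TimeModel.natCast_mul_mem_instants hℓ' _
  | succ n ih =>
    rw [feedbackEnc_feedbackPath_succ]
    split_ifs
    · exact ih
    · exact TimeModel.add_mem_instants (h _) (TimeModel.natCast_mul_mem_instants hℓ' _)

/-- The block indices of the interdeparture times. -/
noncomputable def decodedWord (ℓ : ℝ) (n : ℕ) (d : Fin n → ℝ) (i : Fin n) : ℕ :=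
  blockIndex ℓ (d i - lastDeparture i fun k => d (k.castLE i.isLt.le))

theorem measurable_decodedWord (ℓ : ℝ) (n : ℕ) : Measurable (decodedWord ℓ n) := by
  refine measurable_pi_iff.2 fun i => (measurable_blockIndex ℓ).comp ?_
  exact (measurable_pi_apply i).sub ((measurable_lastDeparture i).comp
    (measurable_pi_iff.2 fun k => measurable_pi_apply _))

/-- The encoder makes every interdeparture time fall into the block that carries the symbol, so a
set of words with bounded sum can be sent without error. -/
theorem IsBlockUniform.nonempty_feedbackCode (hν : IsBlockUniform tm ν ℓ base) {n M m : ℕ} {T : ℝ}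
    (hM : 0 < M) (φ : Fin M → Fin n → ℕ) (hφ : Function.Injective φ)
    (hsum : ∀ u, ∑ i, φ u i ≤ m) (hT : ℓ * m + n * ∫ s, s ∂ν ≤ T) :
    Nonempty (TimingCode tm ν true n M T 0) := by
  have := hν.prob
  have hℓ := hν.pos
  have : Nonempty (Fin M) := ⟨⟨0, hM⟩⟩
  set g : Fin M → ℕ → ℕ := fun u i => if h : i < n then φ u ⟨i, h⟩ else 0 with hg
  have hgφ (u : Fin M) (i : Fin n) : g u i = φ u i := by simp [hg]
  -- Beyond the last packet, the service times are filled up by an arbitrary admissible value.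
  set ext : (Fin n → ℝ) → ℕ → ℝ := fun s i => if h : i < n then s ⟨i, h⟩ else ℓ with hext
  have hext_ae : ∀ᵐ s ∂(Measure.pi fun _ : Fin n => ν),
      ∀ i, 0 < ext s i ∧ ext s i ≤ ℓ ∧ ext s i ∈ tm.instants := by
    filter_upwards [hν.ae_pi_mem n] with s hs i
    simp only [hext]
    split_ifs
    · exact hs _
    · exact ⟨hℓ, le_rfl, hν.mem_instants⟩
  have hpath (u : Fin M) (s : Fin n → ℝ) (i : ℕ) (hi : i ≤ n) :
      (fun k : Fin i => departures (feedbackEnc ℓ (g u)) n s (k.castLE hi)) =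
        feedbackPath ℓ (g u) (ext s) i := by
    rw [departures_castLE, feedbackPath]
    congr 1
    funext k
    simp [hext, k.isLt.trans_le hi, Fin.castLE]
  have hpath' (u : Fin M) (s : Fin n → ℝ) :
      departures (feedbackEnc ℓ (g u)) n s = feedbackPath ℓ (g u) (ext s) n := hpath u s n le_rfl
  have harr (u : Fin M) (s : Fin n → ℝ) (i : Fin n) : arrivals (feedbackEnc ℓ (g u)) n s i =
      feedbackEnc ℓ (g u) i (feedbackPath ℓ (g u) (ext s) i) := by
    rw [arrivals, hpath]
  refine ⟨⟨fun u => feedbackEnc ℓ (g u), fun d => Function.invFun φ (decodedWord ℓ n d),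
    fun u i => measurable_feedbackEnc ℓ _ i,
    (Measurable.of_discrete (f := Function.invFun φ)).comp (measurable_decodedWord ℓ n),
    fun u i => feedbackEnc_causal hℓ _ i, fun h => by simp at h, fun u => ?_, ?_, ?_⟩⟩
  · filter_upwards [hext_ae] with s hs
    have hmono := monotone_feedbackEnc_feedbackPath (g := g u) hℓ fun i => (hs i).1
    refine ⟨fun i => ⟨?_, ?_⟩, fun i j hij => ?_⟩
    · rw [harr]
      refine le_trans ?_ (hmono (Nat.zero_le i))
      exact mul_nonneg hℓ.le (Nat.cast_nonneg _)
    · rw [harr]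
      exact feedbackEnc_feedbackPath_mem_instants hℓ hν.mem_instants (fun i => (hs i).1)
        (fun i => (hs i).2.2) i
    · rw [harr, harr]
      exact hmono hij
  · have h1 (u : Fin M) : ∫⁻ s, ENNReal.ofReal
        (lastDeparture n (departures (feedbackEnc ℓ (g u)) n s)) ∂(Measure.pi fun _ : Fin n => ν)
        ≤ ENNReal.ofReal T := by
      have h2 : ∀ᵐ s ∂(Measure.pi fun _ : Fin n => ν), ENNReal.ofReal
          (lastDeparture n (departures (feedbackEnc ℓ (g u)) n s)) ≤
          ENNReal.ofReal (ℓ * m) + ∑ i, ENNReal.ofReal (s i) := by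
        filter_upwards [hext_ae, hν.ae_pi_mem n] with s hs hs'
        rw [hpath', lastDeparture_feedbackPath hℓ fun i => (hs i).1, Finset.sum_range,
          Finset.sum_add_distrib, ← ENNReal.ofReal_sum_of_nonneg fun i _ => (hs' i).1.le,
          ← ENNReal.ofReal_add (by positivity) (Finset.sum_nonneg fun i _ => (hs' i).1.le)]
        refine ENNReal.ofReal_le_ofReal (add_le_add ?_ (le_of_eq ?_))
        · rw [← Finset.mul_sum]
          refine mul_le_mul_of_nonneg_left ?_ hℓ.le
          simp only [hgφ]
          exact_mod_cast hsum u
        · exact Finset.sum_congr rfl fun i _ => by simp [hext]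
      refine (lintegral_mono_ae h2).trans ?_
      rw [lintegral_add_left measurable_const,
        lintegral_finsetSum _ fun i _ => (measurable_pi_apply i).ennreal_ofReal]
      have h3 (i : Fin n) : ∫⁻ s, ENNReal.ofReal (s i) ∂(Measure.pi fun _ : Fin n => ν) =
          ENNReal.ofReal (∫ s, s ∂ν) := by
        rw [← hν.lintegral_id]
        exact (measurePreserving_eval (fun _ : Fin n => ν) i).lintegral_comp
          ENNReal.measurable_ofReal
      simp only [h3, lintegral_const, measure_univ, mul_one, Finset.sum_const, Finset.card_univ,
        Fintype.card_fin, nsmul_eq_mul]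
      rw [← ENNReal.ofReal_natCast n, ← ENNReal.ofReal_mul (by positivity),
        ← ENNReal.ofReal_add (by positivity) (mul_nonneg (by positivity) hν.mean_pos.le)]
      exact ENNReal.ofReal_le_ofReal hT
    rw [ENNReal.div_le_iff_le_mul (by simp [hM.ne']) (by simp)]
    refine (Finset.sum_le_sum fun u _ => h1 u).trans (le_of_eq ?_)
    simp [mul_comm]
  · have h1 (u : Fin M) : (Measure.pi fun _ : Fin n => ν) {s | Function.invFun φ
        (decodedWord ℓ n (departures (feedbackEnc ℓ (g u)) n s)) ≠ u} = 0 := by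
      change ∀ᵐ s ∂(Measure.pi fun _ : Fin n => ν), Function.invFun φ
        (decodedWord ℓ n (departures (feedbackEnc ℓ (g u)) n s)) = u
      filter_upwards [hext_ae] with s hs
      have h2 : decodedWord ℓ n (departures (feedbackEnc ℓ (g u)) n s) = φ u := by
        funext i
        have h3 := congrFun (hpath u s (i + 1) i.isLt) (Fin.last i)
        have h4 := lastDeparture_feedbackPath_succ (g := g u) hℓ (fun i => (hs i).1) i
        rw [decodedWord, hpath u s i i.isLt.le, ← hgφ u i]
        have h5 : departures (feedbackEnc ℓ (g u)) n s i =
            lastDeparture i (feedbackPath ℓ (g u) (ext s) i) + (ℓ * g u i + ext s i) :=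
          h3.trans h4
        rw [h5, add_sub_cancel_left, blockIndex_add hℓ (hs i).1 (hs i).2.1]
      rw [h2]
      exact Function.leftInverse_invFun hφ u
    simp [h1]

end Feedback

/-! ### The rate of the code with feedback -/

/-- The entropy, in nats, of the geometric law `(1 - ρ) * ρ ^ k` on the natural numbers: the mean of
`-log (1 - ρ) - k * log ρ`, where `ρ / (1 - ρ)` is the mean of `k`. -/
noncomputable def geometricEntropy (ρ : ℝ) : ℝ :=
  -Real.log (1 - ρ) + ρ / (1 - ρ) * -Real.log ρ

theorem log_factorial_le {n : ℕ} (hn : n ≠ 0) :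
    Real.log n.factorial ≤ n * Real.log n - n + Real.log n / 2 + 1 := by
  obtain ⟨m, rfl⟩ := Nat.exists_eq_succ_of_ne_zero hn
  have h := Stirling.log_stirlingSeq'_antitone (Nat.zero_le m)
  simp only [Function.comp, Nat.succ_eq_add_one, zero_add] at h
  rw [Stirling.log_stirlingSeq_formula, Stirling.stirlingSeq_one,
    Real.log_div (Real.exp_ne_zero _) (by positivity), Real.log_exp, Real.log_sqrt (by norm_num),
    Real.log_mul (by norm_num) (by positivity),
    Real.log_div (by positivity) (Real.exp_ne_zero _), Real.log_exp] at h
  simp only [Nat.succ_eq_add_one]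
  linarith

theorem le_log_factorial (n : ℕ) :
    n * Real.log n - n ≤ Real.log n.factorial := by
  rcases Nat.eq_zero_or_pos n with rfl | hn
  · simp
  have h := Real.pow_div_factorial_le_exp (x := n) (Nat.cast_nonneg n) n
  have h1 := Real.log_le_log (by positivity) h
  rw [Real.log_div (by positivity) (by positivity), Real.log_pow, Real.log_exp] at h1
  linarith

theorem le_log_choose {n m : ℕ} (hn : n ≠ 0) (hm : m ≠ 0) :
    n * ((1 + m / n) * Real.log (1 + m / n) - m / n * Real.log (m / n : ℝ)) - Real.log n
      - Real.log (m / n : ℝ) / 2 - 2 ≤ Real.log ((n + m).choose m : ℝ) := by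
  have hn' : (0 : ℝ) < n := by positivity
  have hm' : (0 : ℝ) < m := by positivity
  have h1 := log_factorial_le hn
  have h2 := log_factorial_le hm
  have h3 := le_log_factorial (n + m)
  have h4 : ((n + m).choose m : ℝ) * m.factorial * n.factorial = (n + m).factorial := by
    rw [Nat.add_comm n m]
    have := Nat.add_choose_mul_factorial_mul_factorial m n
    rw [Nat.choose_symm_add.symm] at this
    exact_mod_cast this
  have h5 : 0 < (n + m).choose m := Nat.choose_pos (Nat.le_add_left _ _)
  rw [← h4, Real.log_mul (by positivity) (by positivity),
    Real.log_mul (by positivity) (by positivity)] at h3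
  have h6 : Real.log (1 + m / n) = Real.log (n + m) - Real.log n := by
    rw [← Real.log_div (by positivity) (by positivity)]
    congr 1
    field_simp
  rw [h6, Real.log_div (by positivity) (by positivity)]
  have h7 : (n : ℝ) * ((1 + m / n) * (Real.log (n + m) - Real.log n) -
      m / n * (Real.log m - Real.log n)) =
      (n + m) * Real.log (n + m) - n * Real.log n - m * Real.log m := by
    field_simp
    ring
  rw [h7]
  push_cast at h3
  linarith

/-- There are `exp (n (H + o(1)))` words of length `n + 1` whose sum is `⌊(n + 1) g⌋`, where `H` is
the entropy of the geometric law of mean `g`. -/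
theorem tendsto_log_choose_lower {ρ : ℝ} (hρ : 0 < ρ) (hρ1 : ρ < 1) {D : ℝ}
    (hD : D < geometricEntropy ρ) :
    ∀ᶠ n : ℕ in atTop, D <
      Real.log ((n + ⌊((n + 1 : ℕ) : ℝ) * (ρ / (1 - ρ))⌋₊).choose
        ⌊((n + 1 : ℕ) : ℝ) * (ρ / (1 - ρ))⌋₊ : ℝ) / ((n + 1 : ℕ) : ℝ) := by
  have h1ρ : 0 < 1 - ρ := sub_pos.2 hρ1
  set g := ρ / (1 - ρ) with hg
  have hg0 : 0 < g := by positivity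
  set m : ℕ → ℕ := fun n => ⌊((n + 1 : ℕ) : ℝ) * g⌋₊ with hm
  have hsucc : Tendsto (fun n : ℕ => ((n + 1 : ℕ) : ℝ)) atTop atTop :=
    tendsto_natCast_atTop_atTop.comp (tendsto_add_atTop_nat 1)
  have hn : Tendsto (fun n : ℕ => (n : ℝ)) atTop atTop := tendsto_natCast_atTop_atTop
  have hratio : Tendsto (fun n : ℕ => (n : ℝ) / ((n + 1 : ℕ) : ℝ)) atTop (𝓝 1) := by
    simpa using tendsto_natCast_div_add_atTop (1 : ℝ)
  have hratio' : Tendsto (fun n : ℕ => ((n + 1 : ℕ) : ℝ) / (n : ℝ)) atTop (𝓝 1) := by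
    simpa using hratio.inv₀ one_ne_zero
  have hx : Tendsto (fun n : ℕ => (m n : ℝ) / n) atTop (𝓝 g) := by
    have h1 : Tendsto (fun n : ℕ => (m n : ℝ) / ((n + 1 : ℕ) : ℝ)) atTop (𝓝 g) := by
      have := (tendsto_nat_floor_mul_div_atTop hg0.le).comp hsucc
      refine this.congr fun n => ?_
      simp only [Function.comp, hm, mul_comm g]
    have h2 := h1.mul hratio'
    rw [mul_one] at h2
    refine h2.congr fun n => ?_
    have : ((n + 1 : ℕ) : ℝ) ≠ 0 := by positivity
    field_simp
  have hlogn : Tendsto (fun n : ℕ => Real.log n / n) atTop (𝓝 0) := by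
    have := (Real.isLittleO_log_id_atTop.tendsto_div_nhds_zero).comp hn
    exact this
  have hlogx : Tendsto (fun n : ℕ => Real.log ((m n : ℝ) / n)) atTop (𝓝 (Real.log g)) :=
    hx.log hg0.ne'
  have hmain : Tendsto (fun n : ℕ => (n : ℝ) / ((n + 1 : ℕ) : ℝ) *
      (((1 + (m n : ℝ) / n) * Real.log (1 + (m n : ℝ) / n) -
        (m n : ℝ) / n * Real.log ((m n : ℝ) / n)) - Real.log n / n -
        Real.log ((m n : ℝ) / n) / n / 2 - 2 / n)) atTop
      (𝓝 (1 * ((1 + g) * Real.log (1 + g) - g * Real.log g - 0 - 0 / 2 - 0))) := by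
    refine hratio.mul (((((?_ : Tendsto _ _ _).mul ?_).sub (hx.mul hlogx)).sub hlogn).sub
      ((hlogx.div_atTop hn).div_const 2) |>.sub (tendsto_const_nhds.div_atTop hn))
    · exact tendsto_const_nhds.add hx
    · exact (tendsto_const_nhds.add hx).log (by positivity)
  have hH : 1 * ((1 + g) * Real.log (1 + g) - g * Real.log g - 0 - 0 / 2 - 0) =
      geometricEntropy ρ := by
    have h1 : 1 + g = (1 - ρ)⁻¹ := by rw [hg]; field_simp; ring
    have h2 : Real.log g = Real.log ρ - Real.log (1 - ρ) := by
      rw [hg, Real.log_div hρ.ne' h1ρ.ne']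
    have h3 : Real.log (1 + g) = -Real.log (1 - ρ) := by rw [h1, Real.log_inv]
    rw [geometricEntropy, ← hg, h2, h3]
    ring
  rw [hH] at hmain
  have hmpos : ∀ᶠ n : ℕ in atTop, (0 : ℝ) < (m n : ℝ) / n := hx.eventually_const_lt hg0
  filter_upwards [hmain.eventually_const_lt hD, eventually_gt_atTop 0, hmpos] with n h1 h2 h3
  refine h1.trans_le ?_
  have hm0 : m n ≠ 0 := by
    intro h
    simp [h] at h3
  have h4 := le_log_choose h2.ne' hm0
  have h5 : (0 : ℝ) < ((n + 1 : ℕ) : ℝ) := by positivity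
  have h6 : (0 : ℝ) < n := by exact_mod_cast h2
  rw [le_div_iff₀ h5]
  refine le_trans (le_of_eq ?_) h4
  field_simp

section Feedback

variable {tm : TimeModel} {ν base : Measure ℝ} {ℓ : ℝ}

/-- Words with prescribed sum, indexed by multisets of positions. -/
theorem exists_injective_words (n m : ℕ) :
    ∃ φ : Fin ((n + m).choose m) → Fin (n + 1) → ℕ, Function.Injective φ ∧
      ∀ u, ∑ i, φ u i ≤ m := by
  have hcard : Fintype.card (Sym (Fin (n + 1)) m) = (n + m).choose m := by
    rw [Sym.card_sym_eq_choose, Fintype.card_fin]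
    congr 1
    omega
  let e : Fin ((n + m).choose m) ≃ Sym (Fin (n + 1)) m := (Fintype.equivFinOfCardEq hcard).symm
  refine ⟨fun u i => (e u : Multiset (Fin (n + 1))).count i, fun u v h => ?_, fun u => ?_⟩
  · exact e.injective (Sym.coe_injective (Multiset.ext.2 fun i => congrFun h i))
  · rw [Multiset.sum_count_eq_card fun a _ => Finset.mem_univ a]
    exact (Sym.card_coe).le

theorem IsBlockUniform.achievableAt_feedback (hν : IsBlockUniform tm ν ℓ base) {ρ lam : ℝ}
    (hρ : 0 < ρ) (hρ1 : ρ < 1) (hlam : 0 < lam)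
    (hmean : ℓ * (ρ / (1 - ρ)) + ∫ s, s ∂ν = 1 / lam) :
    AchievableAt tm ν true lam (lam * geometricEntropy ρ / Real.log 2) := by
  intro γ hγ
  have hl2 := Real.log_pos one_lt_two
  have h1ρ : 0 < 1 - ρ := sub_pos.2 hρ1
  have hD : geometricEntropy ρ - γ * Real.log 2 / lam < geometricEntropy ρ := by
    have : 0 < γ * Real.log 2 / lam := by positivity
    linarith
  obtain ⟨N, hN⟩ := eventually_atTop.1 (tendsto_log_choose_lower hρ hρ1 hD)
  set g := ρ / (1 - ρ) with hg
  set m : ℕ → ℕ := fun n => ⌊((n + 1 : ℕ) : ℝ) * g⌋₊ with hm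
  refine ⟨fun k => k + N + 1, fun k => (k + N + m (k + N)).choose (m (k + N)), fun _ => 0,
    tendsto_add_atTop_nat (N + 1), tendsto_const_nhds, fun k => ⟨?_, ?_⟩⟩
  · obtain ⟨φ, hφ, hsum⟩ := exists_injective_words (k + N) (m (k + N))
    refine hν.nonempty_feedbackCode (Nat.choose_pos (Nat.le_add_left _ _)) φ hφ hsum ?_
    have h1 : (m (k + N) : ℝ) ≤ ((k + N + 1 : ℕ) : ℝ) * g := Nat.floor_le (by positivity)
    have h2 := mul_le_mul_of_nonneg_left h1 hν.pos.le
    have h3 : ((k + N + 1 : ℕ) : ℝ) / lam = ((k + N + 1 : ℕ) : ℝ) * (1 / lam) := by ring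
    rw [h3, ← hmean]
    linarith
  · have h1 := hN (k + N) (Nat.le_add_left _ _)
    have h2 := mul_lt_mul_of_pos_left h1 (div_pos hlam hl2)
    refine lt_of_eq_of_lt ?_ (h2.trans_eq ?_)
    · field_simp
    · simp only [hm, Real.logb]
      ring

theorem AchievableAt.achievable {fb : Bool} {lam R : ℝ} (h : AchievableAt tm ν fb lam R)
    (hlam : 0 < lam) : Achievable tm ν fb R := by
  intro γ hγ
  obtain ⟨n, M, ε, hn, hε, hC⟩ := h γ hγ
  refine ⟨n, M, fun k => n k / lam, ε,
    (tendsto_natCast_atTop_atTop.comp hn).atTop_div_const hlam, hε, fun k => ⟨(hC k).1, ?_⟩⟩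
  refine (hC k).2.trans_eq ?_
  rw [div_div_eq_mul_div]
  ring

end Feedback

/-! ### The optimal output law and its tilting -/

/-- The negative log-likelihood, with respect to `base`, of `ℓ G + S` with `G` geometric of ratio
`ρ`. -/
noncomputable def geometricCost (ℓ ρ x : ℝ) : ℝ :=
  -Real.log (1 - ρ) + blockIndex ℓ x * -Real.log ρ

/-- The law of `ℓ G + S` with `G` geometric of ratio `ρ`. -/
noncomputable def geometricOutput (base : Measure ℝ) (ℓ ρ : ℝ) : Measure ℝ :=
  base.withDensity fun x => ENNReal.ofReal (Real.exp (-geometricCost ℓ ρ x))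

/-- There is a bounded statistic `L` with nonpositive mean over every output
`(X - S₁)⁺ + S₂`, but with positive mean over `ℓ G + S` with `G` geometric. -/
def HasSeparatingStatistic (tm : TimeModel) (ν base : Measure ℝ) (ℓ : ℝ) : Prop :=
  ∀ ρ : ℝ, 0 < ρ → ρ < 1 → ∃ (L : ℝ → ℝ) (b : ℝ), Measurable L ∧ (∀ x, |L x| ≤ b) ∧
    (∀ x ∈ tm.instants, ∫ s, ∫ t, L (max (x - s) 0 + t) ∂ν ∂ν ≤ 0) ∧
    0 < ∫ x, L x ∂(geometricOutput base ℓ ρ)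

section Tilt

variable {tm : TimeModel} {ν base : Measure ℝ} {ℓ ρ : ℝ}

theorem measurable_geometricCost (ℓ ρ : ℝ) : Measurable (geometricCost ℓ ρ) :=
  measurable_const.add (((Measurable.of_discrete (f := fun n : ℕ => (n : ℝ))).comp
    (measurable_blockIndex ℓ)).mul_const _)

theorem neg_log_one_sub_pos (hρ : 0 < ρ) (hρ1 : ρ < 1) : 0 < -Real.log (1 - ρ) :=
  neg_pos.2 (Real.log_neg (by linarith) (by linarith))

theorem neg_log_pos (hρ : 0 < ρ) (hρ1 : ρ < 1) : 0 < -Real.log ρ :=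
  neg_pos.2 (Real.log_neg hρ hρ1)

theorem le_geometricCost (hρ : 0 < ρ) (hρ1 : ρ < 1) (x : ℝ) :
    -Real.log (1 - ρ) ≤ geometricCost ℓ ρ x :=
  le_add_of_nonneg_right (mul_nonneg (Nat.cast_nonneg _) (neg_log_pos hρ hρ1).le)

theorem exp_neg_geometricCost (hρ : 0 < ρ) (hρ1 : ρ < 1) (x : ℝ) :
    Real.exp (-geometricCost ℓ ρ x) = (1 - ρ) * ρ ^ blockIndex ℓ x := by
  have h : -geometricCost ℓ ρ x = Real.log (1 - ρ) + blockIndex ℓ x * Real.log ρ := by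
    rw [geometricCost]; ring
  rw [h, Real.exp_add, Real.exp_log (by linarith), Real.exp_nat_mul, Real.exp_log hρ]

theorem tsum_ofReal_geometric (hρ : 0 < ρ) (hρ1 : ρ < 1) :
    ∑' k : ℕ, ENNReal.ofReal ((1 - ρ) * ρ ^ k) = 1 := by
  have h1 : 0 < 1 - ρ := by linarith
  have h := (hasSum_geometric_of_lt_one hρ.le hρ1).mul_left (1 - ρ)
  rw [← ENNReal.ofReal_tsum_of_nonneg (fun k => by positivity) h.summable, h.tsum_eq,
    mul_inv_cancel₀ h1.ne', ENNReal.ofReal_one]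

theorem IsBlockUniform.lintegral_geometricOutput (hν : IsBlockUniform tm ν ℓ base) (hρ : 0 < ρ)
    (hρ1 : ρ < 1) {f : ℝ → ℝ≥0∞} (hf : Measurable f) :
    ∫⁻ x, f x ∂(geometricOutput base ℓ ρ) =
      ∑' k : ℕ, ENNReal.ofReal ((1 - ρ) * ρ ^ k) * ∫⁻ s, f (ℓ * k + s) ∂ν := by
  have hm : Measurable fun x => ENNReal.ofReal (Real.exp (-geometricCost ℓ ρ x)) :=
    (Real.measurable_exp.comp (measurable_geometricCost ℓ ρ).neg).ennreal_ofReal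
  rw [geometricOutput, lintegral_withDensity_eq_lintegral_mul _ hm hf,
    hν.lintegral_base _ (hm.mul hf)]
  refine tsum_congr fun k => ?_
  have hfk : Measurable fun s => f (ℓ * k + s) := hf.comp (measurable_const_add _)
  rw [← lintegral_const_mul _ hfk]
  refine lintegral_congr_ae ?_
  filter_upwards [hν.ae_mem] with s hs
  simp only [Pi.mul_apply, exp_neg_geometricCost hρ hρ1,
    blockIndex_add hν.pos hs.1 hs.2.1]

theorem IsBlockUniform.isProbabilityMeasure_geometricOutput (hν : IsBlockUniform tm ν ℓ base)
    (hρ : 0 < ρ) (hρ1 : ρ < 1) : IsProbabilityMeasure (geometricOutput base ℓ ρ) := by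
  have := hν.prob
  refine ⟨?_⟩
  have h := hν.lintegral_geometricOutput hρ hρ1 (f := fun _ => 1) measurable_const
  simpa [tsum_ofReal_geometric hρ hρ1] using h

theorem IsBlockUniform.integrable_blockIndex (hν : IsBlockUniform tm ν ℓ base) (w : ℝ) :
    Integrable (fun s => (blockIndex ℓ (w + s) : ℝ)) ν := by
  have := hν.prob
  refine Integrable.of_bound (C := (⌈(w + ℓ) / ℓ⌉₊ : ℝ)) ?_ ?_
  · exact ((Measurable.of_discrete (f := fun n : ℕ => (n : ℝ))).comp
      ((measurable_blockIndex ℓ).comp (measurable_const_add w))).aestronglyMeasurable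
  · filter_upwards [hν.ae_mem] with s hs
    rw [Real.norm_eq_abs, Nat.abs_cast, Nat.cast_le]
    refine (Nat.sub_le _ _).trans (Nat.ceil_mono ?_)
    have := hν.pos
    gcongr
    exact hs.2.1

theorem IsBlockUniform.integrable_geometricCost (hν : IsBlockUniform tm ν ℓ base) (w : ℝ) :
    Integrable (fun s => geometricCost ℓ ρ (w + s)) ν := by
  have := hν.prob
  exact (integrable_const _).add ((hν.integrable_blockIndex w).mul_const _)

theorem IsBlockUniform.integral_geometricCost (hν : IsBlockUniform tm ν ℓ base) {w : ℝ}
    (hw : w ∈ tm.instants) (hw0 : 0 ≤ w) :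
    ∫ s, geometricCost ℓ ρ (w + s) ∂ν = -Real.log (1 - ρ) + -Real.log ρ / ℓ * w := by
  have := hν.prob
  unfold geometricCost
  rw [integral_add (integrable_const _) ((hν.integrable_blockIndex w).mul_const _),
    integral_mul_const, hν.integral_blockIndex w hw hw0]
  simp
  ring

theorem IsBlockUniform.ae_max_sub_mem (hν : IsBlockUniform tm ν ℓ base) {x : ℝ}
    (hx : x ∈ tm.instants) : ∀ᵐ s ∂ν, max (x - s) 0 ∈ tm.instants := by
  filter_upwards [hν.ae_mem] with s hs
  exact TimeModel.max_mem_instants (TimeModel.sub_mem_instants hx hs.2.2) tm.zero_mem_instants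

/-- Tilting the geometric cost by a bounded statistic `L` with nonpositive mean over the outputs
`(X - S₁)⁺ + S₂` keeps it affine, and the normalization `Z < 1` lowers its intercept. -/
theorem IsBlockUniform.isAffineCost_tilt (hν : IsBlockUniform tm ν ℓ base) (hρ : 0 < ρ)
    (hρ1 : ρ < 1) {L : ℝ → ℝ} {b θ Z : ℝ} (hL : Measurable L) (hb : ∀ x, |L x| ≤ b)
    (hmean : ∀ x ∈ tm.instants, ∫ s, ∫ t, L (max (x - s) 0 + t) ∂ν ∂ν ≤ 0)
    (hθ : 0 ≤ θ) (hZ : 0 < Z) (hsmall : 0 ≤ -Real.log (1 - ρ) - θ * b + Real.log Z)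
    (hZ1 : ∫ x, Real.exp (-(θ * L x)) ∂(geometricOutput base ℓ ρ) ≤ Z) :
    IsAffineCost tm ν base (fun x => geometricCost ℓ ρ x + θ * L x + Real.log Z)
      (-Real.log (1 - ρ) + Real.log Z) (-Real.log ρ / ℓ) (θ * b) := by
  have := hν.prob
  have := hν.isProbabilityMeasure_geometricOutput hρ hρ1
  have hℓ := hν.pos
  have hb0 : 0 ≤ b := (abs_nonneg _).trans (hb 0)
  have hθb (x : ℝ) : |θ * L x| ≤ θ * b := by
    rw [abs_mul, abs_of_nonneg hθ]
    exact mul_le_mul_of_nonneg_left (hb x) hθ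
  have hB : 0 < -Real.log ρ / ℓ := div_pos (neg_log_pos hρ hρ1) hℓ
  have hLm (w : ℝ) : Integrable (fun t => L (w + t)) ν :=
    Integrable.of_bound (hL.comp (measurable_const_add w)).aestronglyMeasurable b
      (ae_of_all _ fun t => hb _)
  have hc0 (x : ℝ) : 0 ≤ geometricCost ℓ ρ x + θ * L x + Real.log Z := by
    have h1 := le_geometricCost (ℓ := ℓ) hρ hρ1 x
    have h2 := (abs_le.1 (hθb x)).1
    linarith
  have hφb (w : ℝ) : |∫ t, L (w + t) ∂ν| ≤ b := by
    have h := norm_integral_le_of_norm_le_const (μ := ν) (f := fun t => L (w + t)) (C := b)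
      (ae_of_all _ fun t => hb _)
    simpa using h
  have hinner {w : ℝ} (hw : w ∈ tm.instants) (hw0 : 0 ≤ w) :
      ∫⁻ t, ENNReal.ofReal (geometricCost ℓ ρ (w + t) + θ * L (w + t) + Real.log Z) ∂ν =
        ENNReal.ofReal (-Real.log (1 - ρ) + Real.log Z + -Real.log ρ / ℓ * w +
          θ * ∫ t, L (w + t) ∂ν) := by
    have h1 := (hν.integrable_geometricCost (ρ := ρ) w).add ((hLm w).const_mul θ)
    have h2 : Integrable (fun t => geometricCost ℓ ρ (w + t) + θ * L (w + t) + Real.log Z) ν :=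
      h1.add (integrable_const _)
    rw [← ofReal_integral_eq_lintegral_ofReal h2 (ae_of_all _ fun t => hc0 _)]
    congr 1
    rw [integral_add (f := fun t => geometricCost ℓ ρ (w + t) + θ * L (w + t)) h1
        (integrable_const _), integral_add (hν.integrable_geometricCost (ρ := ρ) w)
        ((hLm w).const_mul θ), hν.integral_geometricCost hw hw0, integral_const_mul]
    simp
    ring
  refine ⟨?_, hc0, ?_, ?_, hB.le, mul_nonneg hθ hb0, ?_, ?_⟩
  · exact ((measurable_geometricCost ℓ ρ).add (hL.const_mul θ)).add_const _
  · have hm : Measurable fun x => ENNReal.ofReal (Real.exp (-geometricCost ℓ ρ x)) :=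
      (Real.measurable_exp.comp (measurable_geometricCost ℓ ρ).neg).ennreal_ofReal
    have hm2 : Measurable fun x => Real.exp (-(θ * L x)) :=
      Real.measurable_exp.comp (hL.const_mul θ).neg
    have hint : Integrable (fun x => Real.exp (-(θ * L x))) (geometricOutput base ℓ ρ) := by
      refine Integrable.of_bound hm2.aestronglyMeasurable (Real.exp (θ * b))
        (ae_of_all _ fun x => ?_)
      rw [Real.norm_eq_abs, Real.abs_exp]
      exact Real.exp_le_exp.2 (by linarith [(abs_le.1 (hθb x)).1])
    calc ∫⁻ x, ENNReal.ofReal (Real.exp (-(geometricCost ℓ ρ x + θ * L x + Real.log Z))) ∂base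
        = ∫⁻ x, ENNReal.ofReal (Real.exp (-(θ * L x)) * Z⁻¹) ∂(geometricOutput base ℓ ρ) := by
          rw [geometricOutput, lintegral_withDensity_eq_lintegral_mul _ hm
            (hm2.mul_const _).ennreal_ofReal]
          refine lintegral_congr fun x => ?_
          rw [Pi.mul_apply, ← ENNReal.ofReal_mul (Real.exp_nonneg _), ← mul_assoc, ← Real.exp_add]
          congr 1
          rw [neg_add, Real.exp_add, Real.exp_neg (Real.log Z), Real.exp_log hZ, neg_add]
      _ = ENNReal.ofReal ((∫ x, Real.exp (-(θ * L x)) ∂(geometricOutput base ℓ ρ)) * Z⁻¹) := by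
          rw [← integral_mul_const, ofReal_integral_eq_lintegral_ofReal (hint.mul_const _)]
          exact ae_of_all _ fun x => by positivity
      _ ≤ 1 := by
          rw [← ENNReal.ofReal_one]
          refine ENNReal.ofReal_le_ofReal ?_
          rw [← div_eq_mul_inv]
          exact (div_le_one hZ).2 hZ1
  · linarith [mul_nonneg hθ hb0]
  · intro w hw hw0
    rw [hinner hw hw0, ← ENNReal.ofReal_mul hB.le, ← ENNReal.ofReal_add
      (by linarith [mul_nonneg hθ hb0]) (by positivity), ← ENNReal.ofReal_add
      (add_nonneg (by linarith [mul_nonneg hθ hb0]) (by positivity)) (by positivity)]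
    refine ENNReal.ofReal_le_ofReal ?_
    have := mul_le_mul_of_nonneg_left (abs_le.1 (hφb w)).2 hθ
    linarith
  · intro x hx
    have hW : Integrable (fun s => max (x - s) 0) ν :=
      ((integrable_const x).sub hν.integrable_id).pos_part
    have hφ : Integrable (fun s => ∫ t, L (max (x - s) 0 + t) ∂ν) ν := by
      refine Integrable.of_bound ?_ b (ae_of_all _ fun s => hφb _)
      have h1 : Measurable fun p : ℝ × ℝ => L (max (x - p.1) 0 + p.2) :=
        hL.comp (((measurable_const.sub measurable_fst).max measurable_const).add measurable_snd)
      exact h1.stronglyMeasurable.integral_prod_right'.aestronglyMeasurable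
    have h1 : ∫⁻ s, ∫⁻ t, ENNReal.ofReal (geometricCost ℓ ρ (max (x - s) 0 + t) +
          θ * L (max (x - s) 0 + t) + Real.log Z) ∂ν ∂ν =
        ∫⁻ s, ENNReal.ofReal (-Real.log (1 - ρ) + Real.log Z + -Real.log ρ / ℓ * max (x - s) 0 +
          θ * ∫ t, L (max (x - s) 0 + t) ∂ν) ∂ν := by
      refine lintegral_congr_ae ?_
      filter_upwards [hν.ae_max_sub_mem hx] with s hs
      exact hinner hs (le_max_right _ _)
    have h2 := (integrable_const (μ := ν) (-Real.log (1 - ρ) + Real.log Z)).add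
      (hW.const_mul (-Real.log ρ / ℓ))
    have h3 : Integrable (fun s => -Real.log (1 - ρ) + Real.log Z +
        -Real.log ρ / ℓ * max (x - s) 0 + θ * ∫ t, L (max (x - s) 0 + t) ∂ν) ν :=
      h2.add (hφ.const_mul θ)
    have hEW : 0 ≤ -Real.log ρ / ℓ * ∫ s, max (x - s) 0 ∂ν :=
      mul_nonneg hB.le (integral_nonneg fun s => le_max_right _ _)
    rw [h1, ← ofReal_integral_eq_lintegral_ofReal h3,
      ← ofReal_integral_eq_lintegral_ofReal hW (ae_of_all _ fun s => le_max_right _ _),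
      ← ENNReal.ofReal_mul hB.le, ← ENNReal.ofReal_add (by linarith [mul_nonneg hθ hb0]) hEW]
    · refine ENNReal.ofReal_le_ofReal ?_
      rw [integral_add (f := fun s => -Real.log (1 - ρ) + Real.log Z + -Real.log ρ / ℓ *
          max (x - s) 0) h2 (hφ.const_mul θ), integral_add (integrable_const _)
          (hW.const_mul _), integral_const_mul, integral_const_mul]
      have := mul_nonpos_of_nonneg_of_nonpos hθ (hmean x hx)
      simp
      linarith
    · refine ae_of_all _ fun s => ?_
      have h3 := mul_le_mul_of_nonneg_left (abs_le.1 (hφb (max (x - s) 0))).1 hθ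
      have h4 : 0 ≤ -Real.log ρ / ℓ * max (x - s) 0 := mul_nonneg hB.le (le_max_right _ _)
      simp only [Pi.zero_apply]
      linarith

theorem IsBlockUniform.isAffineCost_geometricCost (hν : IsBlockUniform tm ν ℓ base) (hρ : 0 < ρ)
    (hρ1 : ρ < 1) :
    IsAffineCost tm ν base (geometricCost ℓ ρ) (-Real.log (1 - ρ)) (-Real.log ρ / ℓ) 0 := by
  have := hν.isProbabilityMeasure_geometricOutput hρ hρ1
  have h := hν.isAffineCost_tilt hρ hρ1 (L := fun _ => 0) (b := 0) (θ := 0) (Z := 1)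
    measurable_const (by simp) (by simp) le_rfl one_pos
    (by simpa using (neg_log_one_sub_pos hρ hρ1).le) (by simp)
  simpa using h

/-- For small `θ`, `𝔼[exp (-θ L)] ≤ 1 - θ 𝔼[L] + θ² b²` is less than `1`. -/
theorem IsBlockUniform.exists_isAffineCost_lt (hν : IsBlockUniform tm ν ℓ base)
    (hsep : HasSeparatingStatistic tm ν base ℓ) (hρ : 0 < ρ) (hρ1 : ρ < 1) :
    ∃ δ > 0, ∃ (c : ℝ → ℝ) (K : ℝ),
      IsAffineCost tm ν base c (-Real.log (1 - ρ) - δ) (-Real.log ρ / ℓ) K := by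
  have := hν.isProbabilityMeasure_geometricOutput hρ hρ1
  obtain ⟨L, b, hL, hb, hmean, hpos⟩ := hsep ρ hρ hρ1
  set m := ∫ x, L x ∂(geometricOutput base ℓ ρ) with hm
  have hint : Integrable L (geometricOutput base ℓ ρ) :=
    Integrable.of_bound hL.aestronglyMeasurable b (ae_of_all _ hb)
  have hb0 : 0 ≤ b := (abs_nonneg _).trans (hb 0)
  have ev1 : ∀ᶠ θ : ℝ in 𝓝[>] 0, 0 < 1 - θ * m + θ ^ 2 * b ^ 2 := by
    have : ContinuousAt (fun θ : ℝ => 1 - θ * m + θ ^ 2 * b ^ 2) 0 := by fun_prop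
    exact (this.eventually_const_lt (by simp)).filter_mono nhdsWithin_le_nhds
  have ev2 : ∀ᶠ θ : ℝ in 𝓝[>] 0,
      0 < -Real.log (1 - ρ) - θ * b + Real.log (1 - θ * m + θ ^ 2 * b ^ 2) := by
    have : ContinuousAt
        (fun θ : ℝ => -Real.log (1 - ρ) - θ * b + Real.log (1 - θ * m + θ ^ 2 * b ^ 2)) 0 := by
      refine ContinuousAt.add (by fun_prop) (ContinuousAt.log (by fun_prop) (by simp))
    refine (this.eventually_const_lt ?_).filter_mono nhdsWithin_le_nhds
    simpa using neg_log_one_sub_pos hρ hρ1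
  have ev3 : ∀ᶠ θ : ℝ in 𝓝[>] 0, θ * b < 1 := by
    have : ContinuousAt (fun θ : ℝ => θ * b) 0 := by fun_prop
    exact (this.eventually_lt_const (by simp)).filter_mono nhdsWithin_le_nhds
  have ev4 : ∀ᶠ θ : ℝ in 𝓝[>] 0, θ * b ^ 2 < m := by
    have : ContinuousAt (fun θ : ℝ => θ * b ^ 2) 0 := by fun_prop
    exact (this.eventually_lt_const (by simpa using hpos)).filter_mono nhdsWithin_le_nhds
  obtain ⟨θ, h1, h2, h3, h4, hθ⟩ :=
    (ev1.and (ev2.and (ev3.and (ev4.and self_mem_nhdsWithin)))).exists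
  have hθ : 0 < θ := hθ
  set Z := 1 - θ * m + θ ^ 2 * b ^ 2 with hZ
  have hZ1 : Z < 1 := by nlinarith
  refine ⟨-Real.log Z, neg_pos.2 (Real.log_neg h1 hZ1),
    fun x => geometricCost ℓ ρ x + θ * L x + Real.log Z, θ * b, ?_⟩
  rw [sub_neg_eq_add]
  refine hν.isAffineCost_tilt hρ hρ1 hL hb hmean hθ.le h1 h2.le ?_
  have hpt (x : ℝ) : Real.exp (-(θ * L x)) ≤ 1 - θ * L x + θ ^ 2 * b ^ 2 := by
    have habs : |-(θ * L x)| ≤ θ * b := by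
      rw [abs_neg, abs_mul, abs_of_pos hθ]
      exact mul_le_mul_of_nonneg_left (hb x) hθ.le
    have h5 := (abs_le.1 (Real.abs_exp_sub_one_sub_id_le (habs.trans h3.le))).2
    have h6 := pow_le_pow_left₀ (abs_nonneg _) habs 2
    rw [sq_abs, mul_pow] at h6
    linarith
  have hi1 : Integrable (fun x => 1 - θ * L x) (geometricOutput base ℓ ρ) :=
    (integrable_const _).sub (hint.const_mul θ)
  refine (integral_mono_of_nonneg (ae_of_all _ fun x => (Real.exp_pos _).le)
    (hi1.add (integrable_const (θ ^ 2 * b ^ 2))) (ae_of_all _ hpt)).trans (le_of_eq ?_)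
  simp only [Pi.add_apply]
  rw [integral_add hi1 (integrable_const _), integral_sub (integrable_const _)
    (hint.const_mul θ), integral_const_mul]
  simp [hZ, hm]

end Tilt

/-! ### The two entropy maximization problems -/

/-- The entropy of the model `tm` is, up to the constant `h`, the entropy relative to `base`:
Gibbs' inequality holds, with equality for the reference law itself. -/
structure IsRelativeEntropy (tm : TimeModel) (base : Measure ℝ) (h : ℝ) : Prop where
  entropy_le : ∀ (P : Measure ℝ), IsProbabilityMeasure P → (∀ᵐ x ∂P, 0 < x ∧ x ∈ tm.instants) →
    ∀ c : ℝ → ℝ, Measurable c → (∀ x, 0 ≤ c x) →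
    ∫⁻ x, ENNReal.ofReal (Real.exp (-c x)) ∂base ≤ 1 →
    ∀ D : ℝ, 0 ≤ D → ∫⁻ x, ENNReal.ofReal (c x) ∂P ≤ ENNReal.ofReal D →
      tm.entropy P ≤ ((h + D / Real.log 2 : ℝ) : EReal)
  le_entropy : ∀ c : ℝ → ℝ, Measurable c → (∀ x, 0 ≤ c x) →
    IsProbabilityMeasure (base.withDensity fun x => ENNReal.ofReal (Real.exp (-c x))) →
    ∀ D : ℝ, 0 ≤ D →
    ENNReal.ofReal D ≤ ∫⁻ x, ENNReal.ofReal (c x)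
      ∂(base.withDensity fun x => ENNReal.ofReal (Real.exp (-c x))) →
    ((h + D / Real.log 2 : ℝ) : EReal) ≤
      tm.entropy (base.withDensity fun x => ENNReal.ofReal (Real.exp (-c x)))

/-- The law of `ℓ G` with `G` geometric of ratio `ρ`. -/
noncomputable def geometricWaiting (ℓ ρ : ℝ) : Measure ℝ :=
  Measure.sum fun k : ℕ => ENNReal.ofReal ((1 - ρ) * ρ ^ k) • Measure.dirac (ℓ * k)

section Entropy

theorem TimeModel.measurableSet_instants (tm : TimeModel) : MeasurableSet tm.instants := by
  cases tm
  · exact (Set.countable_range _).measurableSet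
  · exact MeasurableSet.univ

variable {tm : TimeModel} {ν base : Measure ℝ} {ℓ ρ : ℝ}

theorem lintegral_outputLaw (ν Q : Measure ℝ) [SFinite ν] [SFinite Q] {f : ℝ → ℝ≥0∞}
    (hf : Measurable f) :
    ∫⁻ x, f x ∂(outputLaw ν Q) = ∫⁻ w, ∫⁻ s, f (w + s) ∂ν ∂Q := by
  have h : Measurable fun p : ℝ × ℝ => p.1 + p.2 := measurable_fst.add measurable_snd
  rw [outputLaw, lintegral_map hf h]
  exact lintegral_prod _ (hf.comp h).aemeasurable

theorem lintegral_waitingLaw (ν P : Measure ℝ) [SFinite ν] [SFinite P] {f : ℝ → ℝ≥0∞}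
    (hf : Measurable f) :
    ∫⁻ w, f w ∂(waitingLaw ν P) = ∫⁻ x, ∫⁻ s, f (max (x - s) 0) ∂ν ∂P := by
  have h : Measurable fun p : ℝ × ℝ => max (p.1 - p.2) 0 :=
    (measurable_fst.sub measurable_snd).max measurable_const
  rw [waitingLaw, lintegral_map hf h]
  exact lintegral_prod _ (hf.comp h).aemeasurable

instance isProbabilityMeasure_outputLaw (ν Q : Measure ℝ) [IsProbabilityMeasure ν]
    [IsProbabilityMeasure Q] : IsProbabilityMeasure (outputLaw ν Q) :=
  Measure.isProbabilityMeasure_map (measurable_fst.add measurable_snd).aemeasurable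

instance isProbabilityMeasure_waitingLaw (ν P : Measure ℝ) [IsProbabilityMeasure ν]
    [IsProbabilityMeasure P] : IsProbabilityMeasure (waitingLaw ν P) :=
  Measure.isProbabilityMeasure_map
    ((measurable_fst.sub measurable_snd).max measurable_const).aemeasurable

theorem lintegral_geometricWaiting {f : ℝ → ℝ≥0∞} (hf : Measurable f) :
    ∫⁻ w, f w ∂(geometricWaiting ℓ ρ) =
      ∑' k : ℕ, ENNReal.ofReal ((1 - ρ) * ρ ^ k) * f (ℓ * k) := by
  simp [geometricWaiting, lintegral_sum_measure, lintegral_dirac' _ hf]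

theorem isProbabilityMeasure_geometricWaiting (hρ : 0 < ρ) (hρ1 : ρ < 1) :
    IsProbabilityMeasure (geometricWaiting ℓ ρ) := by
  refine ⟨?_⟩
  have h := lintegral_geometricWaiting (ℓ := ℓ) (ρ := ρ) (f := fun _ => 1) measurable_const
  simpa [tsum_ofReal_geometric hρ hρ1] using h

theorem lintegral_id_geometricWaiting (hℓ : 0 ≤ ℓ) (hρ : 0 < ρ) (hρ1 : ρ < 1) :
    ∫⁻ w, ENNReal.ofReal w ∂(geometricWaiting ℓ ρ) = ENNReal.ofReal (ℓ * (ρ / (1 - ρ))) := by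
  have h1 : 0 < 1 - ρ := by linarith
  have h := (hasSum_coe_mul_geometric_of_norm_lt_one
    (by rwa [Real.norm_eq_abs, abs_of_pos hρ] : ‖ρ‖ < 1)).mul_left ((1 - ρ) * ℓ)
  rw [lintegral_geometricWaiting ENNReal.measurable_ofReal]
  have h2 (k : ℕ) : ENNReal.ofReal ((1 - ρ) * ρ ^ k) * ENNReal.ofReal (ℓ * k) =
      ENNReal.ofReal ((1 - ρ) * ℓ * (k * ρ ^ k)) := by
    rw [← ENNReal.ofReal_mul (by positivity)]
    congr 1
    ring
  simp only [h2]
  rw [← ENNReal.ofReal_tsum_of_nonneg (fun k => by positivity) h.summable, h.tsum_eq]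
  congr 1
  field_simp

theorem IsBlockUniform.outputLaw_geometricWaiting (hν : IsBlockUniform tm ν ℓ base) (hρ : 0 < ρ)
    (hρ1 : ρ < 1) : outputLaw ν (geometricWaiting ℓ ρ) = geometricOutput base ℓ ρ := by
  have := hν.prob
  have := isProbabilityMeasure_geometricWaiting (ℓ := ℓ) hρ hρ1
  refine Measure.ext_of_lintegral _ fun f hf => ?_
  have h1 : Measurable fun w => ∫⁻ s, f (w + s) ∂ν :=
    Measurable.lintegral_prod_right' (f := fun p : ℝ × ℝ => f (p.1 + p.2))
      (hf.comp (measurable_fst.add measurable_snd))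
  rw [lintegral_outputLaw _ _ hf, hν.lintegral_geometricOutput hρ hρ1 hf,
    lintegral_geometricWaiting h1]

/-- The waiting time `ℓ G` attains `h + H(G)` in the unrestricted problem. -/
theorem IsBlockUniform.le_maxEntropyFree (hν : IsBlockUniform tm ν ℓ base) {h : ℝ}
    (hE : IsRelativeEntropy tm base h) (hρ : 0 < ρ) (hρ1 : ρ < 1) :
    ((h + geometricEntropy ρ / Real.log 2 : ℝ) : EReal) ≤
      maxEntropyFree tm ν (ℓ * (ρ / (1 - ρ))) := by
  have := hν.prob
  have hQ := isProbabilityMeasure_geometricWaiting (ℓ := ℓ) hρ hρ1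
  have hℓ := hν.pos
  have h1ρ : 0 < 1 - ρ := by linarith
  have hA := neg_log_one_sub_pos hρ hρ1
  have hB : 0 < -Real.log ρ / ℓ := div_pos (neg_log_pos hρ hρ1) hℓ
  have hmem : ∀ᵐ w ∂(geometricWaiting ℓ ρ), 0 ≤ w ∧ w ∈ tm.instants := by
    have hset : MeasurableSet {w : ℝ | 0 ≤ w ∧ w ∈ tm.instants} :=
      measurableSet_Ici.inter tm.measurableSet_instants
    rw [geometricWaiting]
    change Measure.sum _ {w : ℝ | 0 ≤ w ∧ w ∈ tm.instants}ᶜ = 0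
    rw [Measure.sum_apply _ hset.compl, ENNReal.tsum_eq_zero]
    intro k
    rw [Measure.smul_apply, Measure.dirac_apply' _ hset.compl, Set.indicator_of_notMem]
    · simp
    · simp only [Set.mem_compl_iff, not_not]
      exact ⟨by positivity, TimeModel.natCast_mul_mem_instants hν.mem_instants k⟩
  refine le_iSup_of_le ⟨geometricWaiting ℓ ρ, hQ⟩ (le_iSup_of_le hmem (le_iSup_of_le
    (lintegral_id_geometricWaiting hℓ.le hρ hρ1).le ?_))
  rw [ProbabilityMeasure.coe_mk, hν.outputLaw_geometricWaiting hρ hρ1]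
  refine hE.le_entropy _ (measurable_geometricCost ℓ ρ)
    (fun x => hA.le.trans (le_geometricCost hρ hρ1 x))
    (hν.isProbabilityMeasure_geometricOutput hρ hρ1) _
    (add_nonneg hA.le (mul_nonneg (by positivity) (neg_log_pos hρ hρ1).le)) ?_
  change _ ≤ ∫⁻ x, ENNReal.ofReal (geometricCost ℓ ρ x) ∂(geometricOutput base ℓ ρ)
  rw [← hν.outputLaw_geometricWaiting hρ hρ1,
    lintegral_outputLaw _ _ (measurable_geometricCost ℓ ρ).ennreal_ofReal]
  have hcongr : ∫⁻ w, ∫⁻ s, ENNReal.ofReal (geometricCost ℓ ρ (w + s)) ∂ν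
      ∂(geometricWaiting ℓ ρ) = ∫⁻ w, (ENNReal.ofReal (-Real.log (1 - ρ)) +
        ENNReal.ofReal (-Real.log ρ / ℓ) * ENNReal.ofReal w) ∂(geometricWaiting ℓ ρ) := by
    refine lintegral_congr_ae ?_
    filter_upwards [hmem] with w hw
    rw [← ENNReal.ofReal_mul hB.le, ← ENNReal.ofReal_add hA.le (mul_nonneg hB.le hw.1),
      ← hν.integral_geometricCost hw.2 hw.1, ofReal_integral_eq_lintegral_ofReal
      (hν.integrable_geometricCost w)]
    exact ae_of_all _ fun s => hA.le.trans (le_geometricCost hρ hρ1 _)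
  rw [hcongr, lintegral_add_left measurable_const, lintegral_const_mul _ ENNReal.measurable_ofReal,
    lintegral_id_geometricWaiting hℓ.le hρ hρ1, lintegral_const, measure_univ, mul_one,
    ← ENNReal.ofReal_mul hB.le, ← ENNReal.ofReal_add hA.le (by positivity)]
  refine ENNReal.ofReal_le_ofReal (le_of_eq ?_)
  rw [geometricEntropy]
  field_simp

theorem IsBlockUniform.maxEntropySmeared_le (hν : IsBlockUniform tm ν ℓ base) {h : ℝ}
    (hE : IsRelativeEntropy tm base h) {c : ℝ → ℝ} {A B K a : ℝ}
    (hc : IsAffineCost tm ν base c A B K) (ha : 0 ≤ a) :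
    maxEntropySmeared tm ν a ≤ ((h + (A + B * a) / Real.log 2 : ℝ) : EReal) := by
  have := hν.prob
  have hA := hc.intercept_nonneg
  have hB := hc.slope_nonneg
  refine iSup_le fun P => iSup₂_le fun hP hPa => ?_
  refine hE.entropy_le _ inferInstance ?_ c hc.measurable hc.nonneg hc.lintegral_exp_neg_le _
    (by positivity) ?_
  · have hset : MeasurableSet {x : ℝ | 0 < x ∧ x ∈ tm.instants} :=
      measurableSet_Ioi.inter tm.measurableSet_instants
    have h1 : Measurable fun p : ℝ × ℝ => p.1 + p.2 := measurable_fst.add measurable_snd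
    have h2 : Measurable fun p : ℝ × ℝ => max (p.1 - p.2) 0 :=
      (measurable_fst.sub measurable_snd).max measurable_const
    have hset' : MeasurableSet {w : ℝ | 0 ≤ w ∧ w ∈ tm.instants} :=
      measurableSet_Ici.inter tm.measurableSet_instants
    have hW : ∀ᵐ w ∂(waitingLaw ν (P : Measure ℝ)), 0 ≤ w ∧ w ∈ tm.instants := by
      rw [waitingLaw, ae_map_iff h2.aemeasurable hset']
      filter_upwards [Measure.quasiMeasurePreserving_fst.ae hP,
        Measure.quasiMeasurePreserving_snd.ae hν.ae_mem] with p hp hp'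
      exact ⟨le_max_right _ _, TimeModel.max_mem_instants
        (TimeModel.sub_mem_instants hp hp'.2.2) tm.zero_mem_instants⟩
    rw [outputLaw, ae_map_iff h1.aemeasurable hset]
    filter_upwards [Measure.quasiMeasurePreserving_fst.ae hW,
      Measure.quasiMeasurePreserving_snd.ae hν.ae_mem] with p hp hp'
    exact ⟨add_pos_of_nonneg_of_pos hp.1 hp'.1, TimeModel.add_mem_instants hp.2 hp'.2.2⟩
  · have hm := hc.measurable.ennreal_ofReal
    have hm1 : Measurable fun w => ∫⁻ s, ENNReal.ofReal (c (w + s)) ∂ν :=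
      Measurable.lintegral_prod_right' (f := fun p : ℝ × ℝ => ENNReal.ofReal (c (p.1 + p.2)))
        (hm.comp (measurable_fst.add measurable_snd))
    have hm2 : Measurable fun x => ∫⁻ s, ENNReal.ofReal (max (x - s) 0) ∂ν :=
      Measurable.lintegral_prod_right' (f := fun p : ℝ × ℝ => ENNReal.ofReal (max (p.1 - p.2) 0))
        ((measurable_fst.sub measurable_snd).max measurable_const).ennreal_ofReal
    rw [lintegral_outputLaw _ _ hm, lintegral_waitingLaw _ _ hm1]
    rw [lintegral_waitingLaw _ _ ENNReal.measurable_ofReal] at hPa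
    have h1 : ∀ᵐ x ∂(P : Measure ℝ), ∫⁻ s, ∫⁻ t, ENNReal.ofReal (c (max (x - s) 0 + t)) ∂ν ∂ν ≤
        ENNReal.ofReal A + ENNReal.ofReal B * ∫⁻ s, ENNReal.ofReal (max (x - s) 0) ∂ν := by
      filter_upwards [hP] with x hx using hc.smeared_le x hx
    refine (lintegral_mono_ae h1).trans ?_
    rw [lintegral_add_left measurable_const, lintegral_const_mul _ hm2, lintegral_const,
      measure_univ, mul_one, ENNReal.ofReal_add hA (by positivity), ENNReal.ofReal_mul hB]
    gcongr

end Entropy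

/-! ### Comparison of the capacities -/

section Comparison

variable {tm : TimeModel} {ν base : Measure ℝ} {ℓ : ℝ}

/-- With `κ = 𝔼[S] / ℓ`, this is the ratio for which the cost per packet of the geometric cost equals
the cost of waiting for one mean service time; it belongs to the output rate at which the capacity
with feedback is largest. -/
theorem exists_balanced_ratio {κ : ℝ} (hκ : 0 < κ) :
    ∃ ρ : ℝ, 0 < ρ ∧ ρ < 1 ∧ -Real.log (1 - ρ) = κ * -Real.log ρ := by
  have hcont : ContinuousOn (fun ρ : ℝ => 1 - ρ - ρ ^ κ) (Set.Icc 0 1) :=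
    (continuousOn_const.sub continuousOn_id).sub
      (continuousOn_id.rpow_const fun x _ => Or.inr hκ.le)
  have h0 : (0 : ℝ) ∈ Set.Ioo ((fun ρ : ℝ => 1 - ρ - ρ ^ κ) 1) ((fun ρ : ℝ => 1 - ρ - ρ ^ κ) 0) := by
    simp [Real.zero_rpow hκ.ne']
  obtain ⟨ρ, hρ, hρ0⟩ := intermediate_value_Ioo' zero_le_one hcont h0
  refine ⟨ρ, hρ.1, hρ.2, ?_⟩
  have h1 : 1 - ρ = ρ ^ κ := sub_eq_zero.1 hρ0
  rw [h1, Real.log_rpow hρ.1]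
  ring

/-- A mixture of both bounds with a small enough weight `t` on the second one still has a
nonpositive coefficient for packets, and its coefficient for time is less than `B`. -/
theorem capacity_lt_of_hasConverseBound {δ B A' B' : ℝ} (hδ : 0 < δ)
    (h₁ : HasConverseBound tm ν (-δ) B) (h₂ : HasConverseBound tm ν A' B') (hB : B' < B) :
    capacity tm ν false < ((B / Real.log 2 : ℝ) : EReal) := by
  have hden : 0 < δ + |A'| := by positivity
  set t := δ / (δ + |A'|) with ht
  have ht0 : 0 < t := by positivity
  have ht1 : t ≤ 1 := (div_le_one hden).2 (by linarith [abs_nonneg A'])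
  refine (capacity_le_of_hasConverseBound (h₁.convexCombination h₂ ht0.le ht1) ?_).trans_lt
    (EReal.coe_lt_coe_iff.2 (div_lt_div_of_pos_right ?_ (Real.log_pos one_lt_two)))
  · have h3 : t * (δ + |A'|) = δ := div_mul_cancel₀ _ hden.ne'
    have h4 := mul_le_mul_of_nonneg_left (le_abs_self A') ht0.le
    linarith
  · nlinarith

theorem IsBlockUniform.capacity_lt (hν : IsBlockUniform tm ν ℓ base) [SFinite base]
    (hsep : HasSeparatingStatistic tm ν base ℓ) :
    capacity tm ν false < capacity tm ν true := by
  have hσ := hν.mean_pos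
  have hℓ := hν.pos
  have hl2 := Real.log_pos one_lt_two
  obtain ⟨ρ, hρ, hρ1, hbal⟩ := exists_balanced_ratio (div_pos hσ hℓ)
  have h1ρ : 0 < 1 - ρ := by linarith
  obtain ⟨δ, hδ, c, K, hc⟩ := hν.exists_isAffineCost_lt hsep hρ hρ1
  have hlow := hν.hasConverseBound hc
  have hA : -Real.log (1 - ρ) - δ - -Real.log ρ / ℓ * ∫ s, s ∂ν = -δ := by
    rw [hbal]
    field_simp
    ring
  rw [hA] at hlow
  obtain ⟨ρ', hρρ', hρ'1⟩ := exists_between hρ1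
  have hlow' := hν.hasConverseBound (hν.isAffineCost_geometricCost (hρ.trans hρρ') hρ'1)
  refine (capacity_lt_of_hasConverseBound hδ hlow hlow' (div_lt_div_of_pos_right
    (neg_lt_neg (Real.log_lt_log hρ hρρ')) hℓ)).trans_le ?_
  set lam := (ℓ * (ρ / (1 - ρ)) + ∫ s, s ∂ν)⁻¹ with hlam
  have hlam0 : 0 < lam := by positivity
  have hach := (hν.achievableAt_feedback hρ hρ1 hlam0 (by simp [hlam])).achievable hlam0
  have heq : lam * geometricEntropy ρ = -Real.log ρ / ℓ := by
    rw [geometricEntropy, hbal, hlam, inv_mul_eq_iff_eq_mul₀ (by positivity)]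
    field_simp
    ring
  rw [heq] at hach
  exact le_iSup₂_of_le (f := fun (R : ℝ) (_ : Achievable tm ν true R) => (R : EReal)) _ hach le_rfl

theorem IsBlockUniform.feedback_increases_capacity (hν : IsBlockUniform tm ν ℓ base)
    [SFinite base] {h : ℝ} (hE : IsRelativeEntropy tm base h)
    (hsep : HasSeparatingStatistic tm ν base ℓ) :
    (∀ lam : ℝ, 0 < lam → lam < serviceRate ν →
      maxEntropySmeared tm ν (1 / lam - 1 / serviceRate ν)
          < maxEntropyFree tm ν (1 / lam - 1 / serviceRate ν) ∧
        capacityAt tm ν false lam < capacityAt tm ν true lam) ∧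
    capacity tm ν false < capacity tm ν true := by
  refine ⟨fun lam hlam hlam' => ?_, hν.capacity_lt hsep⟩
  have hσ := hν.mean_pos
  have hℓ := hν.pos
  have hl2 := Real.log_pos one_lt_two
  rw [serviceRate] at hlam' ⊢
  rw [one_div (∫ s, s ∂ν)⁻¹, inv_inv]
  set a := 1 / lam - ∫ s, s ∂ν with ha
  have ha0 : 0 < a := by
    rw [ha, sub_pos, one_div]
    exact (lt_inv_comm₀ hlam hσ).1 hlam'
  set ρ := a / (a + ℓ) with hρdef
  have hρ : 0 < ρ := by positivity
  have hρ1 : ρ < 1 := (div_lt_one (by positivity)).2 (by linarith)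
  have hmean : ℓ * (ρ / (1 - ρ)) = a := by
    have : 1 - ρ = ℓ / (a + ℓ) := by
      rw [hρdef]; field_simp; ring
    rw [this, hρdef]
    field_simp
  obtain ⟨δ, hδ, c, K, hc⟩ := hν.exists_isAffineCost_lt hsep hρ hρ1
  have hent : -Real.log (1 - ρ) - δ + -Real.log ρ / ℓ * a = geometricEntropy ρ - δ := by
    rw [geometricEntropy, ← hmean]
    field_simp
    ring
  constructor
  · have h1 := hν.le_maxEntropyFree hE hρ hρ1
    rw [hmean] at h1
    refine ((hν.maxEntropySmeared_le hE hc ha0.le).trans_lt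
      (EReal.coe_lt_coe_iff.2 ?_)).trans_le h1
    rw [hent]
    have := div_lt_div_of_pos_right (sub_lt_self (geometricEntropy ρ) hδ) hl2
    linarith
  · have h1 := hν.achievableAt_feedback hρ hρ1 hlam (by rw [hmean, ha]; ring)
    refine ((capacityAt_le_of_hasConverseBound (hν.hasConverseBound hc) hlam).trans_lt
      (EReal.coe_lt_coe_iff.2 ?_)).trans_le (le_iSup₂_of_le
        (f := fun (R : ℝ) (_ : AchievableAt tm ν true lam R) => (R : EReal)) _ h1 le_rfl)
    refine div_lt_div_of_pos_right ?_ hl2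
    have h2 : geometricEntropy ρ = -Real.log (1 - ρ) - δ + -Real.log ρ / ℓ * a + δ := by
      rw [hent]; ring
    have h3 : lam * (-Real.log (1 - ρ) - δ - -Real.log ρ / ℓ * ∫ s, s ∂ν) + -Real.log ρ / ℓ =
        lam * (-Real.log (1 - ρ) - δ + -Real.log ρ / ℓ * a) := by
      rw [ha]
      field_simp
      ring
    rw [h2, h3, mul_add]
    have : 0 < lam * δ := by positivity
    linarith

end Comparison

/-! ### Discrete time: services uniform on `{1, 2}` -/

section Discrete

/-- The measure with mass `1 / 2` at each positive integer. -/
noncomputable def halfCount : Measure ℝ :=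
  Measure.sum fun k : ℕ => (2⁻¹ : ℝ≥0∞) • Measure.dirac ((k : ℝ) + 1)

instance : SFinite halfCount := by
  have (k : ℕ) : IsFiniteMeasure ((2⁻¹ : ℝ≥0∞) • Measure.dirac ((k : ℝ) + 1)) :=
    Measure.smul_finite _ (by simp)
  unfold halfCount
  infer_instance

theorem lintegral_halfCount (f : ℝ → ℝ≥0∞) :
    ∫⁻ x, f x ∂halfCount = ∑' k : ℕ, 2⁻¹ * f (k + 1) := by
  simp [halfCount, lintegral_sum_measure]

theorem lintegral_uniformOneTwo (f : ℝ → ℝ≥0∞) :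
    ∫⁻ x, f x ∂uniformOneTwo = 2⁻¹ * f 1 + 2⁻¹ * f 2 := by
  simp [uniformOneTwo]

theorem integral_uniformOneTwo (f : ℝ → ℝ) :
    ∫ x, f x ∂uniformOneTwo = (f 1 + f 2) / 2 := by
  have h (a : ℝ) : Integrable f ((2⁻¹ : ℝ≥0∞) • Measure.dirac a) :=
    (integrable_dirac (by simp)).smul_measure (by simp)
  rw [uniformOneTwo, integral_add_measure (h 1) (h 2)]
  simp
  ring

theorem blockIndex_two_odd (i : ℕ) : blockIndex 2 ((2 * i : ℝ) + 1) = i :=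
  blockIndex_add two_pos one_pos one_le_two i

theorem blockIndex_two_even (i : ℕ) : blockIndex 2 ((2 * i : ℝ) + 2) = i :=
  blockIndex_add two_pos two_pos le_rfl i

theorem isBlockUniform_uniformOneTwo : IsBlockUniform .discrete uniformOneTwo 2 halfCount where
  prob := ⟨by
    have := lintegral_uniformOneTwo fun _ => 1
    simpa [ENNReal.inv_two_add_inv_two] using this⟩
  pos := two_pos
  mem_instants := ⟨2, by simp⟩
  ae_mem := by
    rw [uniformOneTwo, ae_add_measure_iff]
    constructor <;> refine Measure.ae_smul_measure ?_ _ <;> rw [ae_dirac_eq] <;>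
      refine ⟨by norm_num, by norm_num, ?_⟩
    · exact ⟨1, by simp⟩
    · exact ⟨2, by simp⟩
  lintegral_base f hf := by
    rw [lintegral_halfCount, ← tsum_even_add_odd ENNReal.summable ENNReal.summable,
      ← ENNReal.tsum_add]
    refine tsum_congr fun k => ?_
    rw [lintegral_uniformOneTwo fun s => f (2 * k + s)]
    push_cast
    rw [add_assoc (2 * (k : ℝ)) 1 1, one_add_one_eq_two]
  lintegral_add_le w hw hw0 f hf := by
    obtain ⟨z, rfl⟩ := hw
    obtain ⟨j, rfl⟩ := Int.eq_ofNat_of_zero_le (Int.cast_nonneg_iff.1 hw0)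
    simp only [Int.cast_natCast]
    rw [lintegral_uniformOneTwo fun s => f (j + s), lintegral_halfCount]
    refine le_trans (le_of_eq ?_) (ENNReal.sum_le_tsum {j, j + 1})
    rw [Finset.sum_pair (by omega)]
    push_cast
    rw [add_assoc (j : ℝ) 1 1, one_add_one_eq_two]
  integral_blockIndex w hw hw0 := by
    obtain ⟨z, rfl⟩ := hw
    obtain ⟨j, rfl⟩ := Int.eq_ofNat_of_zero_le (Int.cast_nonneg_iff.1 hw0)
    simp only [Int.cast_natCast]
    rw [integral_uniformOneTwo fun s => (blockIndex 2 (j + s) : ℝ)]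
    rcases Nat.even_or_odd' j with ⟨i, rfl | rfl⟩
    · push_cast
      rw [blockIndex_two_odd, blockIndex_two_even]
      ring
    · have h1 : ((2 * i + 1 : ℕ) : ℝ) + 1 = 2 * i + 2 := by push_cast; ring
      have h2 : ((2 * i + 1 : ℕ) : ℝ) + 2 = 2 * ((i + 1 : ℕ) : ℝ) + 1 := by push_cast; ring
      rw [h1, h2, blockIndex_two_odd, blockIndex_two_even]
      push_cast
      ring

theorem halfCount_singleton (k : ℤ) :
    halfCount {(k : ℝ)} = if 0 < k then 2⁻¹ else 0 := by
  have h := lintegral_halfCount (Set.indicator {(k : ℝ)} 1)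
  rw [lintegral_indicator_one (measurableSet_singleton _)] at h
  rw [h]
  have hk (j : ℕ) : ((j : ℝ) + 1 ∈ ({(k : ℝ)} : Set ℝ)) ↔ (j : ℤ) + 1 = k := by
    rw [Set.mem_singleton_iff]
    exact_mod_cast Iff.rfl
  split_ifs with hk0
  · obtain ⟨j, hj⟩ := Int.eq_ofNat_of_zero_le (by omega : 0 ≤ k - 1)
    rw [tsum_eq_single j]
    · rw [Set.indicator_of_mem ((hk j).2 (by omega))]
      simp
    · intro i hi
      rw [Set.indicator_of_notMem (mt (hk i).1 (by omega)), mul_zero]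
  · refine ENNReal.tsum_eq_zero.2 fun i => ?_
    rw [Set.indicator_of_notMem (mt (hk i).1 (by omega)), mul_zero]

theorem geometricOutput_real_singleton {ρ : ℝ} (hρ : 0 < ρ) (hρ1 : ρ < 1) {k : ℤ} (hk : 0 < k) :
    (geometricOutput halfCount 2 ρ).real {(k : ℝ)} = (1 - ρ) * ρ ^ blockIndex 2 (k : ℝ) / 2 := by
  have h1ρ : 0 < 1 - ρ := by linarith
  rw [measureReal_def, geometricOutput, withDensity_apply _ (measurableSet_singleton _),
    lintegral_singleton, halfCount_singleton, if_pos hk, exp_neg_geometricCost hρ hρ1,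
    ENNReal.toReal_mul, ENNReal.toReal_ofReal (by positivity)]
  simp
  ring

/-- The statistic `3, -3, 2, -1` at `1, 2, 3, 4`: its mean over `W + S` is half of
`P(W = 2) - P(W = 1) - P(W = 3)`. -/
noncomputable def smearingStatistic (x : ℝ) : ℝ :=
  if x = 1 then 3 else if x = 2 then -3 else if x = 3 then 2 else if x = 4 then -1 else 0

theorem smearingStatistic_intCast (k : ℤ) : smearingStatistic k =
    if k = 1 then 3 else if k = 2 then -3 else if k = 3 then 2 else if k = 4 then -1 else 0 := by
  unfold smearingStatistic
  norm_cast

/-- Since `P((X - S₁)⁺ = k)` is the mean of `P(X = k + 1)` and `P(X = k + 2)` for `k > 0`, the mass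
at `2` is at most the sum of the masses at `1` and at `3`, while `2 G` only takes even values. -/
theorem hasSeparatingStatistic_uniformOneTwo :
    HasSeparatingStatistic .discrete uniformOneTwo halfCount 2 := by
  intro ρ hρ hρ1
  have := isBlockUniform_uniformOneTwo.isProbabilityMeasure_geometricOutput hρ hρ1
  have hmeas : Measurable smearingStatistic := by
    unfold smearingStatistic
    refine Measurable.ite (measurableSet_singleton _) measurable_const ?_
    refine Measurable.ite (measurableSet_singleton _) measurable_const ?_
    refine Measurable.ite (measurableSet_singleton _) measurable_const ?_
    exact Measurable.ite (measurableSet_singleton _) measurable_const measurable_const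
  have hbound (x : ℝ) : |smearingStatistic x| ≤ 3 := by
    unfold smearingStatistic
    split_ifs <;> norm_num
  refine ⟨smearingStatistic, 3, hmeas, hbound, ?_, ?_⟩
  · rintro _ ⟨k, rfl⟩
    simp only [integral_uniformOneTwo]
    have h (i j : ℤ) : smearingStatistic (max ((k : ℝ) - i) 0 + j) =
        smearingStatistic ((max (k - i) 0 + j : ℤ) : ℝ) := by push_cast; rfl
    have h11 := h 1 1
    have h12 := h 1 2
    have h21 := h 2 1
    have h22 := h 2 2
    simp only [Int.cast_one, Int.cast_ofNat] at h11 h12 h21 h22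
    rw [h11, h12, h21, h22]
    simp only [smearingStatistic_intCast]
    rcases le_or_gt k 1 with h1 | h1
    · rw [max_eq_right (by omega : k - 1 ≤ 0), max_eq_right (by omega : k - 2 ≤ 0)]
      norm_num
    · rw [max_eq_left (by omega : 0 ≤ k - 1), max_eq_left (by omega : 0 ≤ k - 2)]
      rcases le_or_gt k 5 with h2 | h2
      · interval_cases k <;> norm_num
      · repeat rw [if_neg (by omega)]
        norm_num
  · have hsupp : ∀ x, x ∉ ((({1, 2, 3, 4} : Finset ℤ).image (fun k : ℤ => (k : ℝ)) : Finset ℝ) :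
        Set ℝ) → smearingStatistic x = 0 := by
      intro x hx
      simp only [Finset.coe_image, Finset.coe_insert, Finset.coe_singleton, Set.image_insert_eq,
        Set.image_singleton, Set.mem_insert_iff, Set.mem_singleton_iff, not_or, Int.cast_one,
        Int.cast_ofNat] at hx
      simp [smearingStatistic, hx.1, hx.2.1, hx.2.2.1, hx.2.2.2]
    have hint : Integrable smearingStatistic (geometricOutput halfCount 2 ρ) :=
      Integrable.of_bound hmeas.aestronglyMeasurable 3 (ae_of_all _ hbound)
    rw [← setIntegral_eq_integral_of_forall_compl_eq_zero hsupp,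
      setIntegral_finset _ hint.integrableOn, Finset.sum_image fun _ _ _ _ h => Int.cast_injective h]
    have hb1 : blockIndex 2 ((1 : ℤ) : ℝ) = 0 := by simpa using blockIndex_two_odd 0
    have hb2 : blockIndex 2 ((2 : ℤ) : ℝ) = 0 := by simpa using blockIndex_two_even 0
    have hb3 : blockIndex 2 ((3 : ℤ) : ℝ) = 1 :=
      (congrArg (blockIndex 2) (by norm_num)).trans (blockIndex_two_odd 1)
    have hb4 : blockIndex 2 ((4 : ℤ) : ℝ) = 1 :=
      (congrArg (blockIndex 2) (by norm_num)).trans (blockIndex_two_even 1)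
    have h1ρ : 0 < 1 - ρ := by linarith
    simp only [Finset.sum_insert (by decide : (1 : ℤ) ∉ ({2, 3, 4} : Finset ℤ)),
      Finset.sum_insert (by decide : (2 : ℤ) ∉ ({3, 4} : Finset ℤ)),
      Finset.sum_insert (by decide : (3 : ℤ) ∉ ({4} : Finset ℤ)), Finset.sum_singleton,
      geometricOutput_real_singleton hρ hρ1 (by decide : (0 : ℤ) < 1),
      geometricOutput_real_singleton hρ hρ1 (by decide : (0 : ℤ) < 2),
      geometricOutput_real_singleton hρ hρ1 (by decide : (0 : ℤ) < 3),
      geometricOutput_real_singleton hρ hρ1 (by decide : (0 : ℤ) < 4), hb1, hb2, hb3, hb4,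
      smearingStatistic_intCast]
    norm_num
    nlinarith [mul_pos h1ρ hρ]

theorem tsum_mul_measure_singleton {P : Measure ℝ} (hP : ∀ᵐ x ∂P, x ∈ TimeModel.discrete.instants)
    (f : ℝ → ℝ≥0∞) : ∑' k : ℤ, f k * P {(k : ℝ)} = ∫⁻ x, f x ∂P := by
  have h : TimeModel.discrete.instants = ⋃ k : ℤ, {(k : ℝ)} := by
    ext x; simp [TimeModel.instants, eq_comm]
  rw [← Measure.restrict_eq_self_of_ae_mem hP, h, lintegral_iUnion
    (fun k => measurableSet_singleton _)]
  · refine tsum_congr fun k => ?_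
    rw [← h, lintegral_singleton, Measure.restrict_eq_self_of_ae_mem hP]
  · intro i j hij
    simpa using hij

theorem ae_halfCount_mem : ∀ᵐ x ∂halfCount, x ∈ TimeModel.discrete.instants := by
  refine (Measure.ae_sum_iff' TimeModel.discrete.measurableSet_instants).2 fun k => ?_
  refine Measure.ae_smul_measure ?_ _
  rw [ae_dirac_eq]
  exact ⟨k + 1, by simp⟩

theorem ofReal_neg_mul_logb (p : ℝ) : ENNReal.ofReal (-(p * Real.logb 2 p)) =
    ENNReal.ofReal (Real.log 2)⁻¹ * ENNReal.ofReal (-(p * Real.log p)) := by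
  rw [← ENNReal.ofReal_mul (by positivity), Real.logb]
  congr 1
  ring

theorem neg_mul_log_add_le {p q : ℝ} (hp : 0 ≤ p) (hq : 0 < q) :
    -(p * Real.log p) + p ≤ p * -Real.log q + q := by
  rcases hp.eq_or_lt with rfl | hp
  · simpa using hq.le
  · have h := Real.log_le_sub_one_of_pos (div_pos hq hp)
    rw [Real.log_div hq.ne' hp.ne'] at h
    have h1 := mul_le_mul_of_nonneg_left h hp.le
    have h2 : p * (q / p - 1) = q - p := by field_simp
    linarith

/-- A bit is the entropy of the uniform law on a pair of consecutive integers. -/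
theorem isRelativeEntropy_halfCount : IsRelativeEntropy .discrete halfCount 1 where
  entropy_le P hP hmem c hc hc0 hc1 D hD hPD := by
    have hl2 := Real.log_pos one_lt_two
    have hmem' : ∀ᵐ x ∂P, x ∈ TimeModel.discrete.instants := hmem.mono fun x hx => hx.2
    have hpt (k : ℤ) : ENNReal.ofReal (-(P.real {(k : ℝ)} * Real.log (P.real {(k : ℝ)}))) +
        1 * P {(k : ℝ)} ≤ (ENNReal.ofReal (c k) * P {(k : ℝ)} +
          ENNReal.ofReal (Real.log 2) * P {(k : ℝ)}) +
          ENNReal.ofReal (Real.exp (-c k)) * halfCount {(k : ℝ)} := by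
      rw [halfCount_singleton]
      rcases le_or_gt k 0 with hk | hk
      · have h0 : P {(k : ℝ)} = 0 := by
          refine measure_mono_null (fun x hx => ?_) hmem
          rw [Set.mem_singleton_iff] at hx
          simp only [Set.mem_compl_iff, Set.mem_ofPred_eq, hx, not_and]
          intro h
          exact absurd h (not_lt.2 (by exact_mod_cast hk))
        simp [measureReal_def, h0]
      · set p := P.real {(k : ℝ)} with hp
        have hp0 : 0 ≤ p := measureReal_nonneg
        have hp1 : p ≤ 1 := measureReal_le_one
        have hPp : P {(k : ℝ)} = ENNReal.ofReal p := by
          rw [hp, ofReal_measureReal]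
        have hlog : 0 ≤ -(p * Real.log p) := by
          rw [neg_nonneg]
          exact mul_nonpos_of_nonneg_of_nonpos hp0 (Real.log_nonpos hp0 hp1)
        have h2 : (2⁻¹ : ℝ≥0∞) = ENNReal.ofReal 2⁻¹ := by
          rw [ENNReal.ofReal_inv_of_pos two_pos]; simp
        rw [if_pos hk, hPp, h2, one_mul, ← ENNReal.ofReal_mul (hc0 _),
          ← ENNReal.ofReal_mul hl2.le, ← ENNReal.ofReal_mul (Real.exp_nonneg _),
          ← ENNReal.ofReal_add hlog hp0,
          ← ENNReal.ofReal_add (mul_nonneg (hc0 _) hp0) (by positivity),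
          ← ENNReal.ofReal_add (add_nonneg (mul_nonneg (hc0 _) hp0) (by positivity))
            (by positivity)]
        refine ENNReal.ofReal_le_ofReal ?_
        have h3 := neg_mul_log_add_le hp0 (q := Real.exp (-c k) * 2⁻¹) (by positivity)
        rw [Real.log_mul (Real.exp_ne_zero _) (by norm_num), Real.log_exp, Real.log_inv] at h3
        linarith
    have hsum := ENNReal.tsum_le_tsum hpt
    rw [ENNReal.tsum_add, ENNReal.tsum_add, ENNReal.tsum_add,
      tsum_mul_measure_singleton hmem' fun _ => 1,
      tsum_mul_measure_singleton hmem' fun x => ENNReal.ofReal (c x),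
      tsum_mul_measure_singleton hmem' fun _ => ENNReal.ofReal (Real.log 2),
      tsum_mul_measure_singleton ae_halfCount_mem fun x => ENNReal.ofReal (Real.exp (-c x))] at hsum
    simp only [lintegral_const, measure_univ, mul_one] at hsum
    have h4 := (ENNReal.add_le_add_iff_right ENNReal.one_ne_top).1
      (hsum.trans (add_le_add (add_le_add hPD le_rfl) hc1))
    change discreteEntropy P ≤ _
    rw [discreteEntropy]
    simp only [ofReal_neg_mul_logb]
    rw [ENNReal.tsum_mul_left]
    have h5 := mul_le_mul_right h4 (ENNReal.ofReal (Real.log 2)⁻¹)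
    rw [← ENNReal.ofReal_add hD hl2.le, ← ENNReal.ofReal_mul (by positivity)] at h5
    refine (EReal.coe_ennreal_le_coe_ennreal_iff.2 h5).trans (le_of_eq ?_)
    rw [EReal.coe_ennreal_ofReal, max_eq_left (by positivity)]
    congr 1
    field_simp
    ring
  le_entropy c hc hc0 hP D hD hPD := by
    have hl2 := Real.log_pos one_lt_two
    set P := halfCount.withDensity fun x => ENNReal.ofReal (Real.exp (-c x)) with hPdef
    have hmem' : ∀ᵐ x ∂P, x ∈ TimeModel.discrete.instants :=
      (withDensity_absolutelyContinuous _ _).ae_le ae_halfCount_mem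
    have hpt (k : ℤ) : ENNReal.ofReal (-(P.real {(k : ℝ)} * Real.log (P.real {(k : ℝ)}))) =
        ENNReal.ofReal (c k) * P {(k : ℝ)} + ENNReal.ofReal (Real.log 2) * P {(k : ℝ)} := by
      have h1 : P {(k : ℝ)} = ENNReal.ofReal (Real.exp (-c k)) * halfCount {(k : ℝ)} := by
        rw [hPdef, withDensity_apply _ (measurableSet_singleton _), lintegral_singleton]
      rw [halfCount_singleton] at h1
      rcases le_or_gt k 0 with hk | hk
      · rw [if_neg hk.not_gt, mul_zero] at h1
        simp [measureReal_def, h1]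
      · have h2 : (2⁻¹ : ℝ≥0∞) = ENNReal.ofReal 2⁻¹ := by
          rw [ENNReal.ofReal_inv_of_pos two_pos]; simp
        rw [if_pos hk, h2, ← ENNReal.ofReal_mul (Real.exp_nonneg _)] at h1
        have h3 : P.real {(k : ℝ)} = Real.exp (-c k) * 2⁻¹ := by
          rw [measureReal_def, h1, ENNReal.toReal_ofReal (by positivity)]
        rw [h3, h1, ← ENNReal.ofReal_mul (hc0 _), ← ENNReal.ofReal_mul hl2.le,
          ← ENNReal.ofReal_add (mul_nonneg (hc0 _) (by positivity)) (by positivity),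
          Real.log_mul (Real.exp_ne_zero _) (by norm_num), Real.log_exp, Real.log_inv]
        congr 1
        ring
    change _ ≤ discreteEntropy P
    rw [discreteEntropy]
    simp only [ofReal_neg_mul_logb, hpt]
    rw [ENNReal.tsum_mul_left, ENNReal.tsum_add,
      tsum_mul_measure_singleton hmem' fun x => ENNReal.ofReal (c x),
      tsum_mul_measure_singleton hmem' fun _ => ENNReal.ofReal (Real.log 2)]
    simp only [lintegral_const, measure_univ, mul_one]
    have h5 := mul_le_mul_right (add_le_add_left hPD (ENNReal.ofReal (Real.log 2)))
      (ENNReal.ofReal (Real.log 2)⁻¹)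
    rw [← ENNReal.ofReal_add hD hl2.le, ← ENNReal.ofReal_mul (by positivity)] at h5
    refine le_trans (le_of_eq ?_) (EReal.coe_ennreal_le_coe_ennreal_iff.2 h5)
    rw [EReal.coe_ennreal_ofReal, max_eq_left (by positivity)]
    congr 1
    field_simp
    ring

end Discrete

/-! ### Continuous time: services uniform on `[0, 1]` -/

section Continuous

theorem uniformUnitInterval_eq_restrict_Ioc :
    uniformUnitInterval = volume.restrict (Set.Ioc 0 1) :=
  Measure.restrict_congr_set Ioc_ae_eq_Icc.symm

theorem lintegral_add_uniformUnitInterval (w : ℝ) (f : ℝ → ℝ≥0∞) :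
    ∫⁻ s, f (w + s) ∂uniformUnitInterval = ∫⁻ x in Set.Ioc w (w + 1), f x := by
  have h := (measurePreserving_add_left (volume : Measure ℝ) w).setLIntegral_comp_preimage_emb
    (measurableEmbedding_addLeft w) f (Set.Ioc w (w + 1))
  rw [uniformUnitInterval_eq_restrict_Ioc, ← h]
  congr 2
  ext x
  simp

theorem iUnion_Ioc_natCast : ⋃ k : ℕ, Set.Ioc (k : ℝ) (k + 1) = Set.Ioi 0 := by
  ext x
  simp only [Set.mem_iUnion, Set.mem_Ioc, Set.mem_Ioi]
  constructor
  · rintro ⟨k, hk, -⟩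
    exact (Nat.cast_nonneg k).trans_lt hk
  · intro hx
    obtain ⟨k, hk⟩ := Nat.exists_eq_succ_of_ne_zero (Nat.ceil_pos.2 hx).ne'
    have h := (Nat.ceil_eq_iff (Nat.succ_ne_zero k)).1 hk
    refine ⟨k, by simpa using h.1, by simpa using h.2⟩

theorem isBlockUniform_uniformUnitInterval :
    IsBlockUniform .continuous uniformUnitInterval 1 (volume.restrict (Set.Ioi 0)) where
  prob := ⟨by simp [uniformUnitInterval]⟩
  pos := one_pos
  mem_instants := trivial
  ae_mem := by
    rw [uniformUnitInterval_eq_restrict_Ioc]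
    filter_upwards [ae_restrict_mem measurableSet_Ioc] with s hs
    exact ⟨hs.1, hs.2, trivial⟩
  lintegral_base f hf := by
    rw [← iUnion_Ioc_natCast, lintegral_iUnion (fun k => measurableSet_Ioc)]
    · refine tsum_congr fun k => ?_
      rw [lintegral_add_uniformUnitInterval, one_mul]
    · intro i j hij
      refine Set.disjoint_left.2 fun x hi hj => hij ?_
      have h1 : (i : ℝ) < j + 1 := hi.1.trans_le hj.2
      have h2 : (j : ℝ) < i + 1 := hj.1.trans_le hi.2
      norm_cast at h1 h2
      omega
  lintegral_add_le w hw hw0 f hf := by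
    rw [lintegral_add_uniformUnitInterval]
    exact lintegral_mono_set fun x hx => hw0.trans_lt hx.1
  integral_blockIndex w hw hw0 := by
    set j := ⌊w⌋₊ with hj
    have hj1 : (j : ℝ) ≤ w := Nat.floor_le hw0
    have hj2 : w < j + 1 := Nat.lt_floor_add_one w
    have hpt : ∀ s ∈ Set.Ioc (0 : ℝ) 1, (blockIndex 1 (w + s) : ℝ) =
        j + (Set.Ioc (1 - (w - j)) 1).indicator 1 s := by
      intro s hs
      rcases le_or_gt s (1 - (w - j)) with h | h
      · rw [Set.indicator_of_notMem fun h' => h.not_gt h'.1, add_zero]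
        have := blockIndex_add one_pos (s := w - j + s) (by linarith [hs.1]) (by linarith) j
        rw [← this]
        congr 2
        ring
      · rw [Set.indicator_of_mem (show s ∈ Set.Ioc (1 - (w - j)) 1 from ⟨h, hs.2⟩)]
        have := blockIndex_add one_pos (s := w - j + s - 1) (by linarith) (by linarith [hs.2])
          (j + 1)
        rw [Pi.one_apply, ← Nat.cast_succ, Nat.succ_eq_add_one, ← this]
        congr 2
        push_cast
        ring
    have hind : Integrable ((Set.Ioc (1 - (w - j)) 1).indicator (1 : ℝ → ℝ))
        (volume.restrict (Set.Ioc 0 1)) := (integrable_const (1 : ℝ)).indicator measurableSet_Ioc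
    rw [uniformUnitInterval_eq_restrict_Ioc, setIntegral_congr_fun measurableSet_Ioc hpt,
      integral_add (integrable_const _) hind,
      integral_indicator_one measurableSet_Ioc, measureReal_restrict_apply measurableSet_Ioc,
      Set.inter_eq_left.2 (Set.Ioc_subset_Ioc_left (by linarith)), Real.volume_real_Ioc_of_le
      (by linarith)]
    simp

/-- The statistic comparing the two sides of the point `2`, between the second and the third
block. -/
noncomputable def dropStatistic (h x : ℝ) : ℝ :=
  (Set.Ioc (2 - h) 2).indicator 1 x - (Set.Ioc 2 (2 + h)).indicator 1 x - 2 * h ^ 2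

theorem measurable_dropStatistic (h : ℝ) : Measurable (dropStatistic h) :=
  ((measurable_one.indicator measurableSet_Ioc).sub
    (measurable_one.indicator measurableSet_Ioc)).sub_const _

theorem abs_dropStatistic_le (h x : ℝ) : |dropStatistic h x| ≤ 2 + 2 * h ^ 2 := by
  have h0 := sq_nonneg h
  unfold dropStatistic
  simp only [Set.indicator_apply, Pi.one_apply]
  split_ifs <;> rw [abs_le] <;> constructor <;> linarith

theorem integral_dropStatistic (h : ℝ) (P : Measure ℝ) [IsProbabilityMeasure P] :
    ∫ x, dropStatistic h x ∂P =
      P.real (Set.Ioc (2 - h) 2) - P.real (Set.Ioc 2 (2 + h)) - 2 * h ^ 2 := by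
  have hi (a b : ℝ) : Integrable ((Set.Ioc a b).indicator (1 : ℝ → ℝ)) P :=
    (integrable_const (1 : ℝ)).indicator measurableSet_Ioc
  unfold dropStatistic
  rw [integral_sub (f := fun x => (Set.Ioc (2 - h) 2).indicator 1 x -
      (Set.Ioc 2 (2 + h)).indicator 1 x) ((hi _ _).sub (hi _ _)) (integrable_const _),
    integral_sub (hi _ _) (hi _ _), integral_indicator_one measurableSet_Ioc,
    integral_indicator_one measurableSet_Ioc]
  simp

/-- `W + S` exceeds `2` by at most `h` at least as likely as it falls short of `2` by less than `h`,
unless `W` is within `h` of `1`. -/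
theorem integral_dropStatistic_add_le {h w : ℝ} (hh : 0 < h) :
    ∫ t, dropStatistic h (w + t) ∂uniformUnitInterval ≤
      (Set.Ioc (1 - h) (1 + h)).indicator (fun _ => h) w - 2 * h ^ 2 := by
  have := isBlockUniform_uniformUnitInterval.prob
  have hmap : Measurable fun t : ℝ => w + t := measurable_const_add w
  have hP : IsProbabilityMeasure (uniformUnitInterval.map fun t => w + t) :=
    Measure.isProbabilityMeasure_map hmap.aemeasurable
  have h1 : ∫ t, dropStatistic h (w + t) ∂uniformUnitInterval =
      ∫ x, dropStatistic h x ∂(uniformUnitInterval.map fun t => w + t) :=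
    (integral_map hmap.aemeasurable (measurable_dropStatistic h).aestronglyMeasurable).symm
  have hreal (a b : ℝ) : (uniformUnitInterval.map fun t => w + t).real (Set.Ioc a b) =
      volume.real (Set.Ioc a b ∩ Set.Ioc w (w + 1)) := by
    rw [measureReal_def, measureReal_def, Measure.map_apply hmap measurableSet_Ioc,
      ← lintegral_indicator_one (hmap measurableSet_Ioc)]
    have h2 := lintegral_add_uniformUnitInterval w (Set.indicator (Set.Ioc a b) 1)
    rw [lintegral_indicator_one measurableSet_Ioc, Measure.restrict_apply measurableSet_Ioc] at h2
    rw [← h2]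
    rfl
  rw [h1, integral_dropStatistic, hreal, hreal]
  refine sub_le_sub_right ?_ _
  have hfin (a b : ℝ) : volume (Set.Ioc a b ∩ Set.Ioc w (w + 1)) ≠ ⊤ :=
    measure_ne_top_of_subset Set.inter_subset_left (by simp)
  have hle : volume.real (Set.Ioc (2 - h) 2 ∩ Set.Ioc w (w + 1)) ≤ h := by
    refine (measureReal_mono Set.inter_subset_left (by simp)).trans ?_
    rw [Real.volume_real_Ioc_of_le (by linarith)]
    linarith
  have hnn : 0 ≤ volume.real (Set.Ioc 2 (2 + h) ∩ Set.Ioc w (w + 1)) := measureReal_nonneg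
  by_cases hw : w ∈ Set.Ioc (1 - h) (1 + h)
  · rw [Set.indicator_of_mem hw]
    linarith
  · rw [Set.indicator_of_notMem hw, sub_nonpos]
    rcases le_or_gt w (1 - h) with h2 | h2
    · have : Set.Ioc (2 - h) 2 ∩ Set.Ioc w (w + 1) = ∅ := by
        refine Set.eq_empty_of_forall_notMem fun x hx => ?_
        linarith [hx.1.1, hx.2.2]
      rw [this]
      simp
    · have h3 : 1 + h < w := by
        by_contra h4
        exact hw ⟨h2, not_lt.1 h4⟩
      rcases le_or_gt w 2 with h4 | h4
      · have : Set.Ioc 2 (2 + h) ∩ Set.Ioc w (w + 1) = Set.Ioc 2 (2 + h) := by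
          refine Set.inter_eq_left.2 fun x hx => ⟨h4.trans_lt hx.1, ?_⟩
          linarith [hx.2]
        rw [this, Real.volume_real_Ioc_of_le (by linarith)]
        linarith
      · have : Set.Ioc (2 - h) 2 ∩ Set.Ioc w (w + 1) = ∅ := by
          refine Set.eq_empty_of_forall_notMem fun x hx => ?_
          linarith [hx.1.2, hx.2.1]
        rw [this]
        simp

theorem geometricOutput_real_Ioc {ρ : ℝ} (hρ : 0 < ρ) (hρ1 : ρ < 1) {a b : ℝ} (k : ℕ)
    (ha : (k : ℝ) ≤ a) (hab : a ≤ b) (hb : b ≤ k + 1) :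
    (geometricOutput (volume.restrict (Set.Ioi 0)) 1 ρ).real (Set.Ioc a b) =
      (1 - ρ) * ρ ^ k * (b - a) := by
  have h1ρ : 0 < 1 - ρ := by linarith
  have h0 : Set.Ioc a b ⊆ Set.Ioi 0 := fun x hx =>
    ((Nat.cast_nonneg k).trans ha).trans_lt hx.1
  rw [measureReal_def, geometricOutput, withDensity_apply _ measurableSet_Ioc,
    Measure.restrict_restrict measurableSet_Ioc, Set.inter_eq_left.2 h0]
  have hpt : ∀ x ∈ Set.Ioc a b, ENNReal.ofReal (Real.exp (-geometricCost 1 ρ x)) =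
      ENNReal.ofReal ((1 - ρ) * ρ ^ k) := by
    intro x hx
    have := blockIndex_add one_pos (s := x - k) (by linarith [hx.1]) (by linarith [hx.2]) k
    rw [one_mul, add_sub_cancel] at this
    rw [exp_neg_geometricCost hρ hρ1, this]
  rw [setLIntegral_congr_fun measurableSet_Ioc hpt, setLIntegral_const, Real.volume_Ioc,
    ENNReal.toReal_mul, ENNReal.toReal_ofReal (by positivity),
    ENNReal.toReal_ofReal (by linarith)]

/-- The law of `(X - S₁)⁺` has a density bounded by `1` on the positive reals, so the density of
the output can only drop slowly near `2`, whereas the density of `G + S` has a jump there. -/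
theorem hasSeparatingStatistic_uniformUnitInterval :
    HasSeparatingStatistic .continuous uniformUnitInterval (volume.restrict (Set.Ioi 0)) 1 := by
  intro ρ hρ hρ1
  have h1ρ : 0 < 1 - ρ := by linarith
  have := isBlockUniform_uniformUnitInterval.isProbabilityMeasure_geometricOutput hρ hρ1
  have hν := isBlockUniform_uniformUnitInterval.prob
  -- The size of the jump of the density of `G + S` at `2` is `4 h`.
  set h := ρ * (1 - ρ) ^ 2 / 4 with hh
  have hh0 : 0 < h := by positivity
  have hh1 : h < 1 := by
    have h2 : ρ * (1 - ρ) ^ 2 ≤ 1 := mul_le_one₀ hρ1.le (by positivity)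
      (pow_le_one₀ h1ρ.le (by linarith))
    rw [hh]
    linarith
  refine ⟨dropStatistic h, 2 + 2 * h ^ 2, measurable_dropStatistic h, abs_dropStatistic_le h,
    fun x _ => ?_, ?_⟩
  · have hbound (s : ℝ) : ∫ t, dropStatistic h (max (x - s) 0 + t) ∂uniformUnitInterval ≤
        (Set.Ico (x - 1 - h) (x - 1 + h)).indicator (fun _ => h) s - 2 * h ^ 2 := by
      refine (integral_dropStatistic_add_le hh0).trans (sub_le_sub_right ?_ _)
      by_cases hw : max (x - s) 0 ∈ Set.Ioc (1 - h) (1 + h)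
      · have h2 : x - s ≤ 1 + h := (le_max_left _ _).trans hw.2
        have h3 : 1 - h < x - s := (lt_max_iff.1 hw.1).resolve_right (by linarith)
        rw [Set.indicator_of_mem hw, Set.indicator_of_mem
          (show s ∈ Set.Ico (x - 1 - h) (x - 1 + h) from ⟨by linarith, by linarith⟩)]
      · rw [Set.indicator_of_notMem hw]
        exact Set.indicator_nonneg (fun _ _ => hh0.le) s
    have hi1 : Integrable (fun s => ∫ t, dropStatistic h (max (x - s) 0 + t) ∂uniformUnitInterval)
        uniformUnitInterval := by
      have h1 : Measurable fun p : ℝ × ℝ => dropStatistic h (max (x - p.1) 0 + p.2) :=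
        (measurable_dropStatistic h).comp
          (((measurable_const.sub measurable_fst).max measurable_const).add measurable_snd)
      refine Integrable.of_bound (C := 2 + 2 * h ^ 2)
        h1.stronglyMeasurable.integral_prod_right'.aestronglyMeasurable (ae_of_all _ fun s => ?_)
      have h2 := norm_integral_le_of_norm_le_const (μ := uniformUnitInterval)
        (f := fun t => dropStatistic h (max (x - s) 0 + t)) (C := 2 + 2 * h ^ 2)
        (ae_of_all _ fun t => abs_dropStatistic_le h _)
      simpa using h2
    have hi2 : Integrable ((Set.Ico (x - 1 - h) (x - 1 + h)).indicator fun _ => h)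
        uniformUnitInterval := (integrable_const h).indicator measurableSet_Ico
    refine (integral_mono hi1 (hi2.sub (integrable_const (2 * h ^ 2))) hbound).trans ?_
    simp only [Pi.sub_apply]
    rw [integral_sub hi2 (integrable_const _), integral_indicator_const _ measurableSet_Ico]
    have hvol : uniformUnitInterval.real (Set.Ico (x - 1 - h) (x - 1 + h)) ≤ 2 * h := by
      have h2 : uniformUnitInterval.real (Set.Ico (x - 1 - h) (x - 1 + h)) ≤
          volume.real (Set.Ico (x - 1 - h) (x - 1 + h)) :=
        ENNReal.toReal_mono (by simp) (Measure.restrict_le_self _)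
      rw [Real.volume_real_Ico_of_le (by linarith)] at h2
      linarith
    have h3 := mul_le_mul_of_nonneg_right hvol hh0.le
    simp
    linarith
  · rw [integral_dropStatistic]
    have e1 := geometricOutput_real_Ioc hρ hρ1 (a := 2 - h) (b := 2) 1
      (by push_cast; linarith) (by linarith) (by push_cast; linarith)
    have e2 := geometricOutput_real_Ioc hρ hρ1 (a := 2) (b := 2 + h) 2
      (by push_cast; linarith) (by linarith) (by push_cast; linarith)
    rw [e1, e2]
    have h3 : (1 - ρ) * ρ ^ 1 * (2 - (2 - h)) - (1 - ρ) * ρ ^ 2 * (2 + h - 2) - 2 * h ^ 2 =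
        2 * h ^ 2 := by
      rw [hh]; ring
    rw [h3]
    positivity

/-- Differential entropy is the entropy relative to Lebesgue measure. -/
theorem isRelativeEntropy_volume_Ioi :
    IsRelativeEntropy .continuous (volume.restrict (Set.Ioi 0)) 0 where
  entropy_le P hP hmem c hc hc0 hc1 D hD hPD := by
    have hl2 := Real.log_pos one_lt_two
    change differentialEntropy P ≤ _
    rw [differentialEntropy]
    split_ifs with hac
    swap
    · exact bot_le
    set f : ℝ → ℝ := fun x => (P.rnDeriv volume x).toReal with hf
    have hfm : Measurable f := (Measure.measurable_rnDeriv P volume).ennreal_toReal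
    have hf0 (x) : 0 ≤ f x := ENNReal.toReal_nonneg
    have hfP : volume.withDensity (fun x => ENNReal.ofReal (f x)) = P := by
      refine (withDensity_congr_ae ?_).trans (Measure.withDensity_rnDeriv_eq P volume hac)
      filter_upwards [Measure.rnDeriv_ne_top P volume] with x hx
      exact ENNReal.ofReal_toReal hx
    have hf1 : ∫⁻ x, ENNReal.ofReal (f x) = 1 := by
      rw [← setLIntegral_univ, ← withDensity_apply _ MeasurableSet.univ, hfP, measure_univ]
    have hfneg : ∀ᵐ x : ℝ, x ≤ 0 → f x = 0 := by
      have h1 : P (Set.Iic 0) = 0 := by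
        refine measure_mono_null (fun x hx => ?_) hmem
        intro h
        exact absurd h.1 (not_lt.2 hx)
      rw [← hfP, withDensity_apply _ measurableSet_Iic,
        setLIntegral_eq_zero_iff measurableSet_Iic hfm.ennreal_ofReal] at h1
      filter_upwards [h1] with x hx hx0
      exact le_antisymm (ENNReal.ofReal_eq_zero.1 (hx hx0)) (hf0 x)
    have hfc : ∫⁻ x, ENNReal.ofReal (f x) * ENNReal.ofReal (c x) ≤ ENNReal.ofReal D := by
      refine le_trans (le_of_eq ?_) hPD
      rw [← hfP, lintegral_withDensity_eq_lintegral_mul _ hfm.ennreal_ofReal hc.ennreal_ofReal]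
      rfl
    have hpt : ∀ᵐ x : ℝ, ENNReal.ofReal (-(f x * Real.log (f x))) + ENNReal.ofReal (f x) ≤
        ENNReal.ofReal (f x) * ENNReal.ofReal (c x) +
          (Set.Ioi 0).indicator (fun x => ENNReal.ofReal (Real.exp (-c x))) x +
          ENNReal.ofReal (f x * Real.log (f x)) := by
      filter_upwards [hfneg] with x hx
      rcases le_or_gt x 0 with hx0 | hx0
      · simp [hx hx0]
      · rw [Set.indicator_of_mem (show x ∈ Set.Ioi 0 from hx0)]
        have h1 := neg_mul_log_add_le (hf0 x) (Real.exp_pos (-c x))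
        rw [Real.log_exp, neg_neg] at h1
        have h2 : 0 ≤ f x * c x := mul_nonneg (hf0 x) (hc0 x)
        have h3 : 0 ≤ Real.exp (-c x) := Real.exp_nonneg _
        rw [← ENNReal.ofReal_mul (hf0 x), ← ENNReal.ofReal_add h2 h3]
        rcases le_total (f x * Real.log (f x)) 0 with h4 | h4
        · rw [← ENNReal.ofReal_add (neg_nonneg.2 h4) (hf0 x)]
          exact (ENNReal.ofReal_le_ofReal h1).trans le_self_add
        · rw [ENNReal.ofReal_of_nonpos (neg_nonpos.2 h4), zero_add,
            ← ENNReal.ofReal_add (add_nonneg h2 h3) h4]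
          exact ENNReal.ofReal_le_ofReal (by linarith)
    have hm1 : Measurable fun x => f x * Real.log (f x) := hfm.mul (Real.measurable_log.comp hfm)
    have hm2 : Measurable fun x => ENNReal.ofReal (f x) * ENNReal.ofReal (c x) :=
      hfm.ennreal_ofReal.mul hc.ennreal_ofReal
    have hsum := lintegral_mono_ae hpt
    rw [lintegral_add_right _ hfm.ennreal_ofReal, lintegral_add_right _ hm1.ennreal_ofReal,
      lintegral_add_left hm2,
      lintegral_indicator measurableSet_Ioi, hf1] at hsum
    have h5 : ∫⁻ x, ENNReal.ofReal (-(f x * Real.log (f x))) ≤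
        ENNReal.ofReal D + ∫⁻ x, ENNReal.ofReal (f x * Real.log (f x)) := by
      refine (ENNReal.add_le_add_iff_right ENNReal.one_ne_top).1 (hsum.trans ?_)
      rw [add_right_comm]
      gcongr
    have hneg (x : ℝ) : ENNReal.ofReal (f x * Real.logb 2 (f x)) =
        ENNReal.ofReal (Real.log 2)⁻¹ * ENNReal.ofReal (f x * Real.log (f x)) := by
      rw [← ENNReal.ofReal_mul (by positivity), Real.logb]
      congr 1
      ring
    change (((∫⁻ x, ENNReal.ofReal (-(f x * Real.logb 2 (f x))) : ℝ≥0∞)) : EReal) -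
      ((∫⁻ x, ENNReal.ofReal (f x * Real.logb 2 (f x)) : ℝ≥0∞) : EReal) ≤ _
    simp only [ofReal_neg_mul_logb, hneg]
    rw [lintegral_const_mul' _ _ ENNReal.ofReal_ne_top,
      lintegral_const_mul' _ _ ENNReal.ofReal_ne_top]
    refine EReal.sub_le_of_le_add ?_
    have h6 := mul_le_mul_right h5 (ENNReal.ofReal (Real.log 2)⁻¹)
    rw [mul_add, ← ENNReal.ofReal_mul (by positivity)] at h6
    refine (EReal.coe_ennreal_le_coe_ennreal_iff.2 h6).trans (le_of_eq ?_)
    rw [EReal.coe_ennreal_add, EReal.coe_ennreal_ofReal, max_eq_left (by positivity), zero_add,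
      div_eq_inv_mul]
  le_entropy c hc hc0 hP D hD hPD := by
    have hl2 := Real.log_pos one_lt_two
    set P := (volume.restrict (Set.Ioi 0)).withDensity
      fun x => ENNReal.ofReal (Real.exp (-c x)) with hPdef
    have hgm : Measurable fun x => ENNReal.ofReal (Real.exp (-c x)) :=
      (Real.measurable_exp.comp hc.neg).ennreal_ofReal
    have hPind : P = volume.withDensity
        ((Set.Ioi 0).indicator fun x => ENNReal.ofReal (Real.exp (-c x))) :=
      (withDensity_indicator measurableSet_Ioi _).symm
    have hac : P ≪ volume := hPind ▸ withDensity_absolutelyContinuous _ _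
    change _ ≤ differentialEntropy P
    rw [differentialEntropy, if_pos hac]
    have hrn : P.rnDeriv volume =ᵐ[volume]
        (Set.Ioi 0).indicator fun x => ENNReal.ofReal (Real.exp (-c x)) := by
      rw [hPind]
      exact Measure.rnDeriv_withDensity _ (hgm.indicator measurableSet_Ioi)
    have hpos : ∀ᵐ x, ENNReal.ofReal
        (-((P.rnDeriv volume x).toReal * Real.logb 2 (P.rnDeriv volume x).toReal)) =
        (Set.Ioi 0).indicator (fun x => ENNReal.ofReal (Real.log 2)⁻¹ *
          (ENNReal.ofReal (Real.exp (-c x)) * ENNReal.ofReal (c x))) x := by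
      filter_upwards [hrn] with x hx
      rw [hx]
      by_cases h : x ∈ Set.Ioi 0
      · rw [Set.indicator_of_mem h, Set.indicator_of_mem h,
          ENNReal.toReal_ofReal (Real.exp_nonneg _), ofReal_neg_mul_logb, Real.log_exp, mul_neg,
          neg_neg, ENNReal.ofReal_mul (Real.exp_nonneg _)]
      · simp [Set.indicator_of_notMem h]
    have hneg : ∀ᵐ x, ENNReal.ofReal
        ((P.rnDeriv volume x).toReal * Real.logb 2 (P.rnDeriv volume x).toReal) = 0 := by
      filter_upwards [hrn] with x hx
      rw [hx, ENNReal.ofReal_eq_zero]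
      refine mul_nonpos_of_nonneg_of_nonpos ENNReal.toReal_nonneg
        (Real.logb_nonpos one_lt_two ENNReal.toReal_nonneg ?_)
      by_cases h : x ∈ Set.Ioi 0
      · rw [Set.indicator_of_mem h, ENNReal.toReal_ofReal (Real.exp_nonneg _)]
        exact Real.exp_le_one_iff.2 (neg_nonpos.2 (hc0 x))
      · simp [Set.indicator_of_notMem h]
    have hgc : Measurable fun x => ENNReal.ofReal (Real.exp (-c x)) * ENNReal.ofReal (c x) :=
      hgm.mul hc.ennreal_ofReal
    rw [lintegral_congr_ae hpos, lintegral_congr_ae hneg, lintegral_zero, EReal.coe_ennreal_zero,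
      sub_zero, lintegral_indicator measurableSet_Ioi,
      lintegral_const_mul _ hgc]
    have h1 : ∫⁻ x in Set.Ioi 0, ENNReal.ofReal (Real.exp (-c x)) * ENNReal.ofReal (c x) =
        ∫⁻ x, ENNReal.ofReal (c x) ∂P := by
      rw [hPdef, lintegral_withDensity_eq_lintegral_mul _ hgm hc.ennreal_ofReal]
      rfl
    rw [h1]
    have h6 := mul_le_mul_right hPD (ENNReal.ofReal (Real.log 2)⁻¹)
    rw [← ENNReal.ofReal_mul (by positivity)] at h6
    refine le_trans (le_of_eq ?_) (EReal.coe_ennreal_le_coe_ennreal_iff.2 h6)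
    rw [EReal.coe_ennreal_ofReal, max_eq_left (by positivity), zero_add, div_eq_inv_mul]

end Continuous

theorem mainTheorem7 :
    ((∀ lam : ℝ, 0 < lam → lam < serviceRate uniformOneTwo →
        maxEntropySmeared .discrete uniformOneTwo (1 / lam - 1 / serviceRate uniformOneTwo)
            < maxEntropyFree .discrete uniformOneTwo (1 / lam - 1 / serviceRate uniformOneTwo) ∧
          capacityAt .discrete uniformOneTwo false lam
            < capacityAt .discrete uniformOneTwo true lam) ∧
      capacity .discrete uniformOneTwo false < capacity .discrete uniformOneTwo true) ∧
    ((∀ lam : ℝ, 0 < lam → lam < serviceRate uniformUnitInterval →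
        maxEntropySmeared .continuous uniformUnitInterval
              (1 / lam - 1 / serviceRate uniformUnitInterval)
            < maxEntropyFree .continuous uniformUnitInterval
              (1 / lam - 1 / serviceRate uniformUnitInterval) ∧
          capacityAt .continuous uniformUnitInterval false lam
            < capacityAt .continuous uniformUnitInterval true lam) ∧
      capacity .continuous uniformUnitInterval false
        < capacity .continuous uniformUnitInterval true) := by
  exact ⟨isBlockUniform_uniformOneTwo.feedback_increases_capacity isRelativeEntropy_halfCount
      hasSeparatingStatistic_uniformOneTwo,
    isBlockUniform_uniformUnitInterval.feedback_increases_capacity isRelativeEntropy_volume_Ioi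
      hasSeparatingStatistic_uniformUnitInterval⟩
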